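/- Let $d\ge 1$, $m\ge 2$, let $\alpha_1,\dots,\alpha_m,\beta\in\{0,1,2,\dots\}^d$ be multi-indices, and suppose that there are vectors $\Lambda,\Gamma\in\{1,2,3,\dots\}^d$ such that \[ \langle\alpha_1,\Lambda\rangle=\langle\alpha_2,\Lambda\rangle=\dots=\langle\alpha_m,\Lambda\rangle=\langle\beta,\Lambda\rangle \quad\text{and}\quad \langle\alpha_1,\Gamma\rangle>\langle\beta,\Gamma\rangle>\langle\alpha_2,\Gamma\rangle\ge\dots\ge\langle\alpha_m,\Gamma\rangle . \] For $N\in\{1,2,3,\dots\}$ let $K_N\in[0,\infty]$ be the smallest constant such that \[ \|D^{\beta}f\|_{L_1(\mathbb T^d)}\le K_N\sum_{j=1}^m\|D^{\alpha_j}f\|_{L_1(\mathbb T^d)} \] for every trigonometric polynomial $f$ on $\mathbb T^d=(\mathbb R/2\pi\mathbb Z)^d$ of degree at most $N$, that is, for every $f(x)=\sum_{q\in\mathbb Z^d,\ \max_i|q_i|\le N}c_q e^{i\langle q,x\rangle}$ with $c_q\in\mathbb C$ (where $K_N=\infty$ if no finite constant works, and $L_1(\mathbb T^d)$ is taken with respect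 to the normalized Haar measure). Then there is a constant $C>0$, independent of $N$, such that for all $N\ge 1$ \[ K_N>C(\ln N)^{\phi},\qquad \phi=\frac12\left(1-\frac{\langle\alpha_1-\beta,\Gamma\rangle}{\langle\alpha_1-\alpha_2,\Gamma\rangle}\right). \] -/

import Mathlib

open scoped ENNReal NNReal

noncomputable section

/-- The character `x ↦ exp (i ⟨q, x⟩)` with frequency `q ∈ ℤ^d`. Functions on the torus `𝕋^d` are
regarded as functions on `ℝ^d` that are `2π`-periodic in every variable. -/
def torusChar {d : ℕ} (q : Fin d → ℤ) (x : Fin d → ℝ) : ℂ :=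
  Complex.exp (Complex.I * ((∑ i, (q i : ℝ) * x i : ℝ) : ℂ))

/-- `f` is a (complex) trigonometric polynomial on `𝕋^d` of degree at most `N`: a linear combination
of characters whose frequencies satisfy `|q i| ≤ N` for all `i`. -/
def IsTrigPolyLE {d : ℕ} (N : ℕ) (f : (Fin d → ℝ) → ℂ) : Prop :=
  ∃ c : (Fin d → ℤ) → ℂ, ∀ x,
    f x = ∑ q ∈ Fintype.piFinset (fun _ : Fin d => Finset.Icc (-(N : ℤ)) (N : ℤ)),
      c q * torusChar q x

/-- The partial derivative `∂f/∂x_i`. -/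
def partialDeriv {d : ℕ} (i : Fin d) (f : (Fin d → ℝ) → ℂ) : (Fin d → ℝ) → ℂ :=
  fun x => lineDeriv ℝ f x (Pi.single i 1)

/-- The mixed derivative `D^μ f = ∂_1^{μ_1} ⋯ ∂_d^{μ_d} f` for a multi-index `μ`. -/
def multiDeriv {d : ℕ} (μ : Fin d → ℕ) (f : (Fin d → ℝ) → ℂ) : (Fin d → ℝ) → ℂ :=
  (List.finRange d).foldr (fun i g => (partialDeriv i)^[μ i] g) f

/-- The norm of `L_1(𝕋^d)` with respect to the normalized Haar measure: the mean value of `‖g‖`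
over the period cell `[0, 2π]^d`. -/
def torusL1Norm {d : ℕ} (g : (Fin d → ℝ) → ℂ) : ℝ :=
  ⨍ x in Set.Icc (0 : Fin d → ℝ) (fun _ => 2 * Real.pi), ‖g x‖

/-- The best constant `K_N` in `‖D^β f‖₁ ≤ K_N ∑_{j=1}^m ‖D^{α_j} f‖₁` over trigonometric
polynomials of degree at most `N`; it is `∞` if there is no finite constant. -/
def bestConst {d : ℕ} (m : ℕ) (α : ℕ → Fin d → ℕ) (β : Fin d → ℕ) (N : ℕ) : ℝ≥0∞ :=
  ⨅ (K : ℝ≥0) (_ : ∀ f : (Fin d → ℝ) → ℂ, IsTrigPolyLE N f →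
      torusL1Norm (multiDeriv β f) ≤
        K * ∑ j ∈ Finset.Icc 1 m, torusL1Norm (multiDeriv (α j) f)), (K : ℝ≥0∞)

end

noncomputable section

/-! Take very lacunary frequencies a_0, a_1, … and let P_k be the product over j < k of Fejér
kernels of order M_j in the variable ⟨a_j, x⟩. P_k is nonnegative with mean 1, so ‖P_k‖₁ = 1 for
every k. The polynomial f (`extremal`) is a sum of 2b blocks, the k-th being an approximate
D^{α₁}-primitive of P_{k+1} - P_k. Hence D^{α₁} f telescopes to P_{2b} - P_0 up to a small error,
and its norm is bounded independently of b.

A different derivative D^γ multiplies the k-th increment, up to powers of M_k, by the ratio of the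
symbols of D^γ and D^{α₁} at a_k. With a_k = s^{EkΛ + e_kΓ} (coordinatewise powers) the common
Λ-weight cancels, so the ratio is s^{-e_k⟨α₁-γ,Γ⟩}: Λ provides lacunarity and Γ controls sizes. For
even k, M_k = 2 and e_k = 1. For odd k, M_k = b and e_k is so large that the increment is negligible
for every γ with ⟨γ,Γ⟩ < ⟨α₁,Γ⟩. Such derivatives retain only every other increment, which destroys
the telescoping.

Put p = ⟨α₁-α₂,Γ⟩, r = ⟨β-α₂,Γ⟩, b = s^p. For j ≥ 2 the triangle inequality over the b even blocks
gives ‖D^{α_j} f‖₁ = O(1) (`Lacunary.nrm_D_extremal_le`). For β the even increments do not cancel,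
so ‖D^β f‖₁ is at least a constant times b s^{-⟨α₁-β,Γ⟩} = s^r (`Lacunary.le_nrm_D_extremal`). This
is seen by duality. Let t_i = (1 + cos⟨a_{2i+1},x⟩)/2 and let H be the sum over j < b of
e^{-i⟨a_{2j},x⟩} t_0⋯t_{j-1}(1 - t_j). Then |H| ≤ 1. The odd Fejér factors of order b concentrate
P_{2j} where t_0, …, t_{j-1} are close to 1, while t_j is still independent of P_{2j}, so every even
increment pairs with H to a fixed proportion of its size.

The degree of f is at most s^{C s^p}, so ln N is at most of order s^p ln s, which is crudely bounded
by s^{2p}, and s^r dominates (ln N)^{r/(2p)} with r/(2p) = φ. -/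

/-- Trigonometric polynomials on `𝕋^d`, as finitely supported families of Fourier coefficients with
the convolution product. -/
abbrev TrigPoly (d : ℕ) : Type := AddMonoidAlgebra ℂ (Fin d → ℤ)

namespace TrigPoly

/-! ### Evaluation, Fourier multipliers and derivatives. -/

section

variable {d : ℕ}

theorem torusChar_zero (x : Fin d → ℝ) : torusChar 0 x = 1 := by
  simp [torusChar]

theorem torusChar_add (q r : Fin d → ℤ) (x : Fin d → ℝ) :
    torusChar (q + r) x = torusChar q x * torusChar r x := by
  simp only [torusChar, ← Complex.exp_add, ← mul_add, ← Complex.ofReal_add,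
    ← Finset.sum_add_distrib]
  congr 4
  ext i
  simp [add_mul]

theorem norm_torusChar (q : Fin d → ℤ) (x : Fin d → ℝ) : ‖torusChar q x‖ = 1 := by
  rw [torusChar, mul_comm, Complex.norm_exp_ofReal_mul_I]

theorem torusChar_neg (q : Fin d → ℤ) (x : Fin d → ℝ) :
    torusChar (-q) x = (starRingEnd ℂ) (torusChar q x) := by
  rw [torusChar, torusChar, ← Complex.exp_conj]
  simp

@[fun_prop]
theorem continuous_torusChar (q : Fin d → ℤ) : Continuous (torusChar q) := by
  unfold torusChar
  fun_prop

/-- Evaluation of a trigonometric polynomial as a function of `x ∈ ℝ^d`. -/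
def ev : TrigPoly d →ₐ[ℂ] ((Fin d → ℝ) → ℂ) :=
  AddMonoidAlgebra.lift ℂ _ _
    { toFun := fun q => torusChar q.toAdd
      map_one' := funext torusChar_zero
      map_mul' := fun q r => funext fun x => torusChar_add q.toAdd r.toAdd x }

/-- The character with frequency `q`. -/
abbrev ch (q : Fin d → ℤ) : TrigPoly d := AddMonoidAlgebra.single q 1

theorem ev_single (q : Fin d → ℤ) (c : ℂ) (x : Fin d → ℝ) :
    ev (AddMonoidAlgebra.single q c) x = c * torusChar q x := by
  simp [ev]

theorem ev_ch (q : Fin d → ℤ) (x : Fin d → ℝ) : ev (ch q) x = torusChar q x := by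
  simp [ev_single]

theorem ev_apply (f : TrigPoly d) (x : Fin d → ℝ) :
    ev f x = ∑ q ∈ f.coeff.support, f.coeff q * torusChar q x := by
  conv_lhs => rw [← AddMonoidAlgebra.sum_coeff_single f]
  rw [Finsupp.sum, map_sum, Finset.sum_apply]
  simp only [ev_single]

@[fun_prop]
theorem continuous_ev (f : TrigPoly d) : Continuous (ev f) := by
  have : ev f = fun x => ∑ q ∈ f.coeff.support, f.coeff q * torusChar q x := funext (ev_apply f)
  rw [this]
  fun_prop

/-- The Fourier multiplier with symbol `σ`. -/
def mult (σ : (Fin d → ℤ) → ℂ) : TrigPoly d →ₗ[ℂ] TrigPoly d where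
  toFun f := .ofCoeff (Finsupp.onFinset f.coeff.support (fun q => σ q * f.coeff q) (by
    intro q hq
    simp only [Finsupp.mem_support_iff]
    exact right_ne_zero_of_mul hq))
  map_add' f g := by ext q; simp [mul_add]
  map_smul' c f := by ext q; simp; ring

theorem coeff_mult (σ : (Fin d → ℤ) → ℂ) (f : TrigPoly d) (q : Fin d → ℤ) :
    (mult σ f).coeff q = σ q * f.coeff q := rfl

theorem mult_mult (σ τ : (Fin d → ℤ) → ℂ) (f : TrigPoly d) :
    mult σ (mult τ f) = mult (σ * τ) f := by
  ext q; simp [coeff_mult, mul_assoc]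

theorem mult_one (f : TrigPoly d) : mult 1 f = f := by
  ext q; simp [coeff_mult]

theorem mult_single (σ : (Fin d → ℤ) → ℂ) (q : Fin d → ℤ) (c : ℂ) :
    mult σ (AddMonoidAlgebra.single q c) = AddMonoidAlgebra.single q (σ q * c) := by
  ext r
  rw [coeff_mult]
  by_cases h : q = r
  · subst h; simp
  · simp [h]

theorem hasLineDerivAt_torusChar (q : Fin d → ℤ) (i : Fin d) (x : Fin d → ℝ) :
    HasLineDerivAt ℝ (torusChar q) (Complex.I * q i * torusChar q x) x (Pi.single i 1) := by
  unfold HasLineDerivAt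
  have h1 : (fun t : ℝ => torusChar q (x + t • Pi.single i 1)) =
      fun t : ℝ => torusChar q x * Complex.exp (Complex.I * q i * (t : ℂ)) := by
    funext t
    rw [torusChar, torusChar, ← Complex.exp_add]
    congr 1
    simp only [Pi.add_apply, Pi.smul_apply, smul_eq_mul, mul_add, Finset.sum_add_distrib]
    have : ∑ j, (q j : ℝ) * (t * (Pi.single i (1 : ℝ) : Fin d → ℝ) j) = q i * t := by
      rw [Finset.sum_eq_single i]
      · simp
      · intro j _ hj; simp [hj]
      · simp
    rw [this]
    push_cast
    ring
  rw [h1]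
  have h2 : HasDerivAt (fun t : ℝ => Complex.I * q i * (t : ℂ)) (Complex.I * q i * 1) 0 :=
    (HasDerivAt.ofReal_comp (hasDerivAt_id (0 : ℝ))).const_mul _
  have h3 := (h2.cexp).const_mul (torusChar q x)
  simp only [Complex.ofReal_zero, mul_zero, Complex.exp_zero, mul_one, one_mul] at h3
  convert! h3 using 1
  ring

theorem partialDeriv_ev (i : Fin d) (f : TrigPoly d) :
    partialDeriv i (ev f) = ev (mult (fun q => Complex.I * q i) f) := by
  funext x
  have h : HasLineDerivAt ℝ (ev f) (ev (mult (fun q => Complex.I * q i) f) x) x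
      (Pi.single i 1) := by
    induction f using AddMonoidAlgebra.induction_linear with
    | zero => simpa using! hasDerivAt_const (0 : ℝ) (0 : ℂ)
    | add f g hf hg =>
      simp only [map_add, Pi.add_apply]
      exact HasDerivAt.add hf hg
    | single q c =>
      have := HasDerivAt.const_mul c (hasLineDerivAt_torusChar q i x)
      rw [mult_single, ev_single]
      have e : ev (AddMonoidAlgebra.single q c) = fun y => c * torusChar q y :=
        funext (ev_single q c)
      rw [e]
      have e' : Complex.I * (q i : ℂ) * c * torusChar q x =
          c * (Complex.I * q i * torusChar q x) := by ring
      rw [e']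
      exact this
  exact h.lineDeriv

theorem iterate_partialDeriv_ev (i : Fin d) (n : ℕ) (f : TrigPoly d) :
    (partialDeriv i)^[n] (ev f) = ev (mult (fun q => (Complex.I * q i) ^ n) f) := by
  induction n generalizing f with
  | zero => simpa using! congrArg ev (mult_one f).symm
  | succ n ih =>
    rw [Function.iterate_succ_apply, partialDeriv_ev, ih, mult_mult]
    congr 2

/-- The symbol `(i q)^γ` of `D^γ`. -/
def symb (γ : Fin d → ℕ) (q : Fin d → ℤ) : ℂ := ∏ i, (Complex.I * q i) ^ γ i

/-- The mixed derivative `D^γ` on trigonometric polynomials. -/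
abbrev D (γ : Fin d → ℕ) : TrigPoly d →ₗ[ℂ] TrigPoly d := mult (symb γ)

theorem multiDeriv_ev (γ : Fin d → ℕ) (f : TrigPoly d) : multiDeriv γ (ev f) = ev (D γ f) := by
  have key : ∀ l : List (Fin d), l.foldr (fun i g => (partialDeriv i)^[γ i] g) (ev f) =
      ev (mult (fun q => (l.map fun i => (Complex.I * q i) ^ γ i).prod) f) := by
    intro l
    induction l with
    | nil => simpa using! congrArg ev (mult_one f).symm
    | cons i l ih =>
      rw [List.foldr_cons, ih, iterate_partialDeriv_ev, mult_mult]
      congr 2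
  rw [multiDeriv, key]
  congr 2

/-- `L_1` norm of a trigonometric polynomial. -/
def nrm (f : TrigPoly d) : ℝ := torusL1Norm (ev f)

end

/-! ### Means and the `L_1` norm. -/

section

variable {d : ℕ}

open MeasureTheory

/-- Normalized Lebesgue measure on the period cell. -/
def cellMeasure (d : ℕ) : Measure (Fin d → ℝ) :=
  ((volume.restrict (Set.Icc (0 : Fin d → ℝ) fun _ => 2 * Real.pi)) Set.univ)⁻¹ •
    volume.restrict (Set.Icc (0 : Fin d → ℝ) fun _ => 2 * Real.pi)

instance : IsProbabilityMeasure (cellMeasure d) := by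
  have h0 : (volume.restrict (Set.Icc (0 : Fin d → ℝ) fun _ => 2 * Real.pi)) Set.univ ≠ 0 := by
    rw [Measure.restrict_apply_univ, Real.volume_Icc_pi]
    simp [Real.pi_pos]
  have h1 : (volume.restrict (Set.Icc (0 : Fin d → ℝ) fun _ => 2 * Real.pi)) Set.univ ≠ ⊤ := by
    rw [Measure.restrict_apply_univ, Real.volume_Icc_pi]
    simp [ENNReal.mul_eq_top]
  constructor
  rw [cellMeasure, Measure.smul_apply, smul_eq_mul, ENNReal.inv_mul_cancel h0 h1]

theorem integrable_of_continuous {E : Type*} [NormedAddCommGroup E] {g : (Fin d → ℝ) → E}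
    (hg : Continuous g) : Integrable g (cellMeasure d) := by
  refine Integrable.smul_measure hg.integrableOn_Icc ?_
  rw [Measure.restrict_apply_univ, Real.volume_Icc_pi]
  simp [Real.pi_pos]

theorem nrm_eq_integral (f : TrigPoly d) : nrm f = ∫ x, ‖ev f x‖ ∂cellMeasure d := rfl

theorem integral_torusChar (q : Fin d → ℤ) :
    ∫ x, torusChar q x ∂cellMeasure d = if q = 0 then 1 else 0 := by
  split_ifs with h
  · subst h
    simp [torusChar_zero]
  · obtain ⟨i, hi⟩ := Function.ne_iff.1 h
    rw [cellMeasure, integral_smul_measure, ← Set.pi_univ_Icc, volume_pi, Measure.restrict_pi_pi]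
    have e : ∀ x : Fin d → ℝ, torusChar q x = ∏ j, Complex.exp (Complex.I * q j * (x j : ℂ)) := by
      intro x
      rw [torusChar, ← Complex.exp_sum, Complex.ofReal_sum, Finset.mul_sum]
      congr 1
      refine Finset.sum_congr rfl fun j _ => ?_
      push_cast
      ring
    simp_rw [e]
    rw [integral_fintype_prod_eq_prod (fun j (y : ℝ) => Complex.exp (Complex.I * q j * (y : ℂ))),
      Finset.prod_eq_zero (Finset.mem_univ i), smul_zero]
    have hi' : (Complex.I * q i : ℂ) ≠ 0 := by
      simpa using hi
    rw [integral_Icc_eq_integral_Ioc, ← intervalIntegral.integral_of_le (by simp [Real.pi_pos.le]),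
      integral_exp_mul_complex hi']
    have : Complex.exp (Complex.I * q i * ((2 * Real.pi : ℝ) : ℂ)) = 1 := by
      rw [Complex.exp_eq_one_iff]
      exact ⟨q i, by push_cast; ring⟩
    rw [this]
    simp

theorem integral_ev (f : TrigPoly d) : ∫ x, ev f x ∂cellMeasure d = f.coeff 0 := by
  induction f using AddMonoidAlgebra.induction_linear with
  | zero => simp
  | add f g hf hg =>
    simp only [map_add, Pi.add_apply, AddMonoidAlgebra.coeff_add, Finsupp.add_apply]
    rw [integral_add (integrable_of_continuous (by fun_prop))
      (integrable_of_continuous (by fun_prop)), hf, hg]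
  | single q c =>
    simp only [ev_single, integral_const_mul, integral_torusChar]
    by_cases h : q = 0
    · subst h; simp
    · simp [h]

theorem nrm_add_le (f g : TrigPoly d) : nrm (f + g) ≤ nrm f + nrm g := by
  simp only [nrm_eq_integral]
  rw [← integral_add (integrable_of_continuous (by fun_prop))
    (integrable_of_continuous (by fun_prop))]
  refine integral_mono (integrable_of_continuous (by fun_prop))
    (integrable_of_continuous (by fun_prop)) fun x => ?_
  simpa using norm_add_le (ev f x) (ev g x)

theorem nrm_smul (c : ℂ) (f : TrigPoly d) : nrm (c • f) = ‖c‖ * nrm f := by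
  simp [nrm_eq_integral, integral_const_mul]

theorem nrm_zero : nrm (0 : TrigPoly d) = 0 := by
  simp [nrm_eq_integral]

theorem nrm_sub_le (f g : TrigPoly d) : nrm (f - g) ≤ nrm f + nrm g := by
  have h := nrm_add_le f ((-1 : ℂ) • g)
  rw [nrm_smul] at h
  simpa [sub_eq_add_neg] using h

theorem nrm_sum_le {ι : Type*} (s : Finset ι) (f : ι → TrigPoly d) :
    nrm (∑ i ∈ s, f i) ≤ ∑ i ∈ s, nrm (f i) :=
  Finset.le_sum_of_subadditive nrm nrm_zero.le nrm_add_le s f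

theorem nrm_ch_mul (q : Fin d → ℤ) (f : TrigPoly d) : nrm (ch q * f) = nrm f := by
  simp [nrm_eq_integral, ev_ch, norm_torusChar]

/-- Duality between `L_1` and the sup norm: the lower bound for the β-derivative is obtained by
pairing with a test function bounded by 1. -/
theorem norm_coeff_zero_mul_le (f h : TrigPoly d) (hh : ∀ x, ‖ev h x‖ ≤ 1) :
    ‖(f * h).coeff 0‖ ≤ nrm f := by
  rw [← integral_ev, nrm_eq_integral]
  refine (norm_integral_le_integral_norm _).trans ?_
  refine integral_mono (integrable_of_continuous (by fun_prop))
    (integrable_of_continuous (by fun_prop)) fun x => ?_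
  simpa using mul_le_of_le_one_right (norm_nonneg (ev f x)) (hh x)

theorem nrm_eq_of_nonneg (f : TrigPoly d) (g : (Fin d → ℝ) → ℝ) (hg : ∀ x, 0 ≤ g x)
    (hfg : ∀ x, ev f x = g x) : (nrm f : ℂ) = f.coeff 0 := by
  rw [← integral_ev, nrm_eq_integral, ← integral_complex_ofReal]
  refine integral_congr_ae (Filter.Eventually.of_forall fun x => ?_)
  simp [hfg, abs_of_nonneg (hg x)]

/-! ### Leibniz estimates -/

/-- The monomial `x^γ`. -/
def mono (x : Fin d → ℝ) (γ : Fin d → ℕ) : ℝ := ∏ i, x i ^ γ i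

theorem mono_zero (x : Fin d → ℝ) : mono x 0 = 1 := by simp [mono]

theorem mono_add_single (x : Fin d → ℝ) (γ : Fin d → ℕ) (i : Fin d) :
    mono x (γ + Pi.single i 1) = x i * mono x γ := by
  simp only [mono, Pi.add_apply, pow_add, Finset.prod_mul_distrib]
  rw [mul_comm, Finset.prod_eq_single i (fun j _ hj => by simp [hj]) (by simp)]
  simp

theorem symb_add_single (γ : Fin d → ℕ) (i : Fin d) (q : Fin d → ℤ) :
    symb (γ + Pi.single i 1) q = Complex.I * q i * symb γ q := by
  simp only [symb, Pi.add_apply, pow_add, Finset.prod_mul_distrib]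
  rw [mul_comm, Finset.prod_eq_single i (fun j _ hj => by simp [hj]) (by simp)]
  simp

theorem symb_zero (q : Fin d → ℤ) : symb 0 q = 1 := by simp [symb]

theorem mono_nonneg {x : Fin d → ℝ} (hx : ∀ i, 0 ≤ x i) (γ : Fin d → ℕ) : 0 ≤ mono x γ :=
  Finset.prod_nonneg fun i _ => pow_nonneg (hx i) _

theorem mono_pos {x : Fin d → ℝ} (hx : ∀ i, 0 < x i) (γ : Fin d → ℕ) : 0 < mono x γ :=
  Finset.prod_pos fun i _ => pow_pos (hx i) _

theorem mono_le_mono {x y : Fin d → ℝ} (hx : ∀ i, 0 ≤ x i) (hxy : ∀ i, x i ≤ y i)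
    (γ : Fin d → ℕ) : mono x γ ≤ mono y γ :=
  Finset.prod_le_prod (fun i _ => pow_nonneg (hx i) _)
    fun i _ => pow_le_pow_left₀ (hx i) (hxy i) _

theorem mono_smul (c : ℝ) (x : Fin d → ℝ) (γ : Fin d → ℕ) :
    mono (fun i => c * x i) γ = c ^ (∑ i, γ i) * mono x γ := by
  simp [mono, mul_pow, Finset.prod_mul_distrib, Finset.prod_pow_eq_pow_sum]

theorem norm_symb (γ : Fin d → ℕ) (q : Fin d → ℤ) :
    ‖symb γ q‖ = mono (fun i => |(q i : ℝ)|) γ := by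
  simp [symb, mono, norm_prod]

theorem multiIndex_induction {P : (Fin d → ℕ) → Prop} (h0 : P 0)
    (h1 : ∀ γ i, P γ → P (γ + Pi.single i 1)) (γ : Fin d → ℕ) : P γ := by
  induction hn : ∑ i, γ i generalizing γ with
  | zero =>
    have : γ = 0 := by
      funext i
      exact (Finset.sum_eq_zero_iff.1 hn) i (Finset.mem_univ i)
    exact this ▸ h0
  | succ n ih =>
    have : ∃ i, γ i ≠ 0 := by
      by_contra! h
      simp [h] at hn
    obtain ⟨i, hi⟩ := this
    have e : γ = (γ - Pi.single i 1) + Pi.single i 1 := by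
      funext j
      by_cases hj : j = i
      · subst hj; simp; omega
      · simp [hj]
    rw [e] at hn ⊢
    refine h1 _ _ (ih _ ?_)
    simpa [Finset.sum_add_distrib] using hn

theorem D_zero (f : TrigPoly d) : D 0 f = f := by
  ext q; simp [coeff_mult, symb_zero]

theorem D_add_single (γ : Fin d → ℕ) (i : Fin d) (f : TrigPoly d) :
    D (γ + Pi.single i 1) f = D (Pi.single i 1) (D γ f) := by
  ext q
  have := symb_add_single 0 i q
  simp only [zero_add] at this
  rw [coeff_mult, coeff_mult, coeff_mult, symb_add_single, this, symb_zero]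
  ring

theorem D_comm (γ γ' : Fin d → ℕ) (f : TrigPoly d) : D γ (D γ' f) = D γ' (D γ f) := by
  ext q; simp only [coeff_mult]; ring

theorem D_single_ch_mul (i : Fin d) (q : Fin d → ℤ) (f : TrigPoly d) :
    D (Pi.single i 1) (ch q * f) =
      ch q * ((Complex.I * q i) • f + D (Pi.single i 1) f) := by
  have hs : ∀ r : Fin d → ℤ, symb (Pi.single i 1) r = Complex.I * r i := by
    intro r
    have := symb_add_single 0 i r
    simpa [symb_zero] using this
  induction f using AddMonoidAlgebra.induction_linear with
  | zero => simp
  | add f g hf hg =>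
    rw [mul_add, map_add, hf, hg, map_add, smul_add, ← mul_add]
    congr 1
    abel
  | single r c =>
    rw [AddMonoidAlgebra.single_mul_single, mult_single, mult_single, hs, hs,
      AddMonoidAlgebra.smul_single, ← AddMonoidAlgebra.single_add,
      AddMonoidAlgebra.single_mul_single]
    congr 1
    simp
    ring

/-- `f` satisfies the Bernstein type estimates `‖D^γ f‖₁ ≤ c A^γ`. -/
def Bernstein (c : ℝ) (A : Fin d → ℝ) (f : TrigPoly d) : Prop :=
  ∀ γ, nrm (D γ f) ≤ c * mono A γ

theorem Bernstein.add {c c' : ℝ} {A : Fin d → ℝ} {f g : TrigPoly d} (hf : Bernstein c A f)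
    (hg : Bernstein c' A g) : Bernstein (c + c') A (f + g) := fun γ => by
  rw [map_add, add_mul]
  exact (nrm_add_le _ _).trans (add_le_add (hf γ) (hg γ))

theorem Bernstein.smul {c : ℝ} {A : Fin d → ℝ} {f : TrigPoly d} (hf : Bernstein c A f) (z : ℂ) :
    Bernstein (‖z‖ * c) A (z • f) := fun γ => by
  rw [map_smul, nrm_smul, mul_assoc]
  exact mul_le_mul_of_nonneg_left (hf γ) (norm_nonneg _)

theorem Bernstein.D_single {c : ℝ} {A : Fin d → ℝ} {f : TrigPoly d} (hf : Bernstein c A f)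
    (i : Fin d) : Bernstein (c * A i) A (D (Pi.single i 1) f) := fun γ => by
  rw [D_comm, ← D_add_single]
  refine (hf _).trans_eq ?_
  rw [mono_add_single]
  ring

/-- Conjugating `D^γ` by a character, with the leading term removed. -/
theorem exists_D_ch_mul {c : ℝ} {A : Fin d → ℝ} {f : TrigPoly d} (hf : Bernstein c A f)
    (q : Fin d → ℤ) (γ : Fin d → ℕ) :
    ∃ g, D γ (ch q * f) = ch q * (symb γ q • f + g) ∧
      Bernstein (c * (mono (fun i => |(q i : ℝ)| + A i) γ - mono (fun i => |(q i : ℝ)|) γ)) A g := by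
  induction γ using multiIndex_induction with
  | h0 =>
    refine ⟨0, by simp [D_zero, symb_zero], fun γ => ?_⟩
    simp [mono_zero, nrm_zero]
  | h1 γ i ih =>
    obtain ⟨g, hg, hB⟩ := ih
    -- Product rule for one more derivative. It falls on `g` as well, so the induction carries
    -- Bernstein bounds of all orders for `g`. With Q = |q_i|, A = A_i the constants combine through
    -- Am + Q(m' - m) + A(m' - m) = (Q + A)m' - Qm.
    refine ⟨symb γ q • D (Pi.single i 1) f + ((Complex.I * q i) • g + D (Pi.single i 1) g), ?_, ?_⟩
    · rw [D_add_single, hg, D_single_ch_mul, symb_add_single]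
      congr 1
      rw [smul_add, smul_smul, map_add, map_smul]
      abel
    · have h := ((hf.D_single i).smul (symb γ q)).add
        ((hB.smul (Complex.I * q i)).add (hB.D_single i))
      convert! h using 1
      rw [mono_add_single, mono_add_single, norm_symb]
      simp
      ring

theorem nrm_D_ch_mul_le {c : ℝ} {A : Fin d → ℝ} {f : TrigPoly d} (hf : Bernstein c A f)
    (q : Fin d → ℤ) (γ : Fin d → ℕ) :
    nrm (D γ (ch q * f)) ≤ c * mono (fun i => |(q i : ℝ)| + A i) γ := by
  obtain ⟨g, hg, hB⟩ := exists_D_ch_mul hf q γ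
  rw [hg, nrm_ch_mul]
  have h1 := (nrm_add_le (symb γ q • f) g)
  have h2 := hB 0
  have h3 := hf 0
  rw [D_zero, mono_zero] at h2 h3
  rw [nrm_smul, norm_symb] at h1
  have h4 : 0 ≤ mono (fun i => |(q i : ℝ)|) γ := mono_nonneg (fun i => abs_nonneg _) γ
  have h5 := mul_le_mul_of_nonneg_left h3 h4
  linarith

/-- When every `A i` is small compared with `|q i|`, the right side is a small fraction of the main
term: `D γ` acts on the product almost as if it saw only the character. -/
theorem nrm_D_ch_mul_sub_le {c : ℝ} {A : Fin d → ℝ} {f : TrigPoly d} (hf : Bernstein c A f)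
    (q : Fin d → ℤ) (γ : Fin d → ℕ) :
    nrm (D γ (ch q * f) - symb γ q • (ch q * f)) ≤
      c * (mono (fun i => |(q i : ℝ)| + A i) γ - mono (fun i => |(q i : ℝ)|) γ) := by
  obtain ⟨g, hg, hB⟩ := exists_D_ch_mul hf q γ
  have e : D γ (ch q * f) - symb γ q • (ch q * f) = ch q * g := by
    rw [hg, mul_add, mul_smul_comm]
    abel
  have h2 := hB 0
  rw [D_zero, mono_zero, mul_one] at h2
  rw [e, nrm_ch_mul]
  exact h2

end

section

variable {d : ℕ}

/-! ### Degrees and independence -/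

/-- All frequencies `q` of `f` satisfy `|q i| ≤ ρ i`. -/
def DegLE (ρ : Fin d → ℝ) (f : TrigPoly d) : Prop :=
  ∀ q, f.coeff q ≠ 0 → ∀ i, |(q i : ℝ)| ≤ ρ i

theorem DegLE.mono {ρ ρ' : Fin d → ℝ} {f : TrigPoly d} (hf : DegLE ρ f) (h : ∀ i, ρ i ≤ ρ' i) :
    DegLE ρ' f := fun q hq i => (hf q hq i).trans (h i)

theorem DegLE.add {ρ : Fin d → ℝ} {f g : TrigPoly d} (hf : DegLE ρ f) (hg : DegLE ρ g) :
    DegLE ρ (f + g) := fun q hq i => by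
  by_cases h : f.coeff q = 0
  · refine hg q (fun h' => hq ?_) i
    simp [h, h']
  · exact hf q h i

theorem DegLE.smul {ρ : Fin d → ℝ} {f : TrigPoly d} (hf : DegLE ρ f) (c : ℂ) :
    DegLE ρ (c • f) := fun q hq i => hf q (fun h => hq (by simp [h])) i

theorem DegLE.sub {ρ : Fin d → ℝ} {f g : TrigPoly d} (hf : DegLE ρ f) (hg : DegLE ρ g) :
    DegLE ρ (f - g) := by
  simpa [sub_eq_add_neg] using hf.add (hg.smul (-1))

theorem DegLE.sum {ι : Type*} {ρ : Fin d → ℝ} {s : Finset ι} {f : ι → TrigPoly d}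
    (hf : ∀ j ∈ s, DegLE ρ (f j)) : DegLE ρ (∑ j ∈ s, f j) :=
  Finset.sum_induction _ _ (fun _ _ => DegLE.add) (fun q hq => by simp at hq) hf

theorem DegLE.mul {ρ ρ' : Fin d → ℝ} {f g : TrigPoly d} (hf : DegLE ρ f) (hg : DegLE ρ' g) :
    DegLE (fun i => ρ i + ρ' i) (f * g) := fun q hq i => by
  classical
  have h := AddMonoidAlgebra.support_coeff_mul_subset f g (Finsupp.mem_support_iff.2 hq)
  obtain ⟨r, hr, t, ht, rfl⟩ := Finset.mem_add.1 h
  have h1 := hf r (Finsupp.mem_support_iff.1 hr) i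
  have h2 := hg t (Finsupp.mem_support_iff.1 ht) i
  simp only [Pi.add_apply, Int.cast_add]
  exact (abs_add_le _ _).trans (add_le_add h1 h2)

theorem coeff_ch_of_ne {q r : Fin d → ℤ} (h : q ≠ r) : (ch q : TrigPoly d).coeff r = 0 := by
  rw [AddMonoidAlgebra.coeff_single, Finsupp.single_eq_of_ne h.symm]

theorem degLE_ch {ρ : Fin d → ℝ} {q : Fin d → ℤ} (h : ∀ i, |(q i : ℝ)| ≤ ρ i) :
    DegLE ρ (ch q) := fun r hr i => by
  have : q = r := by
    by_contra hne
    simp [hne] at hr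
  exact this ▸ h i

theorem degLE_one {ρ : Fin d → ℝ} (h : ∀ i, 0 ≤ ρ i) : DegLE ρ (1 : TrigPoly d) := by
  rw [AddMonoidAlgebra.one_def]
  exact degLE_ch (by simpa using h)

/-- All frequencies of `u` are integer multiples of `a`. -/
def Ray (a : Fin d → ℤ) (u : TrigPoly d) : Prop := ∀ q, u.coeff q ≠ 0 → ∃ m : ℤ, q = m • a

theorem Ray.add {a : Fin d → ℤ} {f g : TrigPoly d} (hf : Ray a f) (hg : Ray a g) :
    Ray a (f + g) := fun q hq => by
  by_cases h : f.coeff q = 0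
  · refine hg q fun h' => hq ?_
    simp [h, h']
  · exact hf q h

theorem Ray.smul {a : Fin d → ℤ} {f : TrigPoly d} (hf : Ray a f) (c : ℂ) :
    Ray a (c • f) := fun q hq => hf q fun h => hq (by simp [h])

theorem Ray.sub {a : Fin d → ℤ} {f g : TrigPoly d} (hf : Ray a f) (hg : Ray a g) :
    Ray a (f - g) := by
  simpa [sub_eq_add_neg] using hf.add (hg.smul (-1))

theorem Ray.sum {ι : Type*} {a : Fin d → ℤ} {s : Finset ι} {f : ι → TrigPoly d}
    (hf : ∀ j ∈ s, Ray a (f j)) : Ray a (∑ j ∈ s, f j) :=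
  Finset.sum_induction _ _ (fun _ _ => Ray.add) (fun q hq => by simp at hq) hf

theorem Ray.mul {a : Fin d → ℤ} {f g : TrigPoly d} (hf : Ray a f) (hg : Ray a g) :
    Ray a (f * g) := fun q hq => by
  classical
  have h := AddMonoidAlgebra.support_coeff_mul_subset f g (Finsupp.mem_support_iff.2 hq)
  obtain ⟨r, hr, t, ht, rfl⟩ := Finset.mem_add.1 h
  obtain ⟨m, rfl⟩ := hf r (Finsupp.mem_support_iff.1 hr)
  obtain ⟨n, rfl⟩ := hg t (Finsupp.mem_support_iff.1 ht)
  exact ⟨m + n, (add_smul m n a).symm⟩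

theorem ray_ch_zsmul (a : Fin d → ℤ) (m : ℤ) : Ray a (ch (m • a)) := fun r hr => by
  refine ⟨m, ?_⟩
  by_contra hne
  exact hr (coeff_ch_of_ne (Ne.symm hne))

theorem ray_ch (a : Fin d → ℤ) : Ray a (ch a) := by
  simpa using ray_ch_zsmul a 1

theorem ray_ch_neg (a : Fin d → ℤ) : Ray a (ch (-a)) := by
  simpa using ray_ch_zsmul a (-1)

theorem ray_one (a : Fin d → ℤ) : Ray a (1 : TrigPoly d) := by
  simpa [AddMonoidAlgebra.one_def] using ray_ch_zsmul a 0

/-- Independence: a polynomial of low degree and a polynomial in the character of a high frequency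
have multiplicative means. -/
theorem coeff_zero_mul {ρ : Fin d → ℝ} {a : Fin d → ℤ} {G u : TrigPoly d} (i : Fin d)
    (hG : DegLE ρ G) (hu : Ray a u) (h : ρ i < a i) :
    (G * u).coeff 0 = G.coeff 0 * u.coeff 0 := by
  classical
  rw [AddMonoidAlgebra.coeff_mul_apply_right, Finsupp.sum]
  rw [Finset.sum_eq_single 0]
  · simp
  · intro q hq hq0
    obtain ⟨m, rfl⟩ := hu q (Finsupp.mem_support_iff.1 hq)
    have hm : m ≠ 0 := by
      rintro rfl
      simp at hq0
    have : G.coeff (0 + -(m • a)) = 0 := by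
      by_contra hne
      have h1 := hG _ hne i
      have h2 : (1 : ℝ) ≤ |(m : ℝ)| := by exact_mod_cast Int.one_le_abs hm
      simp only [zero_add, Pi.neg_apply, Pi.smul_apply, smul_eq_mul, Int.cast_neg, Int.cast_mul,
        abs_neg, abs_mul] at h1
      have h3 := le_abs_self (a i : ℝ)
      have h4 := mul_le_mul_of_nonneg_right h2 (abs_nonneg (a i : ℝ))
      linarith
    rw [this, zero_mul]
  · intro h0
    simp [Finsupp.notMem_support_iff.1 h0]

/-! ### Fejér kernels -/

/-- The Fejér kernel of order `M` in the variable `⟨a, x⟩`. -/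
def fejer (M : ℕ) (a : Fin d → ℤ) : TrigPoly d :=
  (M : ℂ)⁻¹ • ∑ j ∈ Finset.range M, ∑ l ∈ Finset.range M, ch (((j : ℤ) - l) • a)

theorem ray_fejer (M : ℕ) (a : Fin d → ℤ) : Ray a (fejer M a) :=
  (Ray.sum fun _ _ => Ray.sum fun _ _ => ray_ch_zsmul _ _).smul _

theorem degLE_fejer (M : ℕ) {a : Fin d → ℤ} (ha : ∀ i, 0 < a i) :
    DegLE (fun i => M * (a i : ℝ)) (fejer M a) := by
  refine (DegLE.sum fun j hj => DegLE.sum fun l hl => degLE_ch fun i => ?_).smul _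
  have h1 : |((j : ℝ) - l)| ≤ M := by
    have hj' : (j : ℝ) < M := by exact_mod_cast Finset.mem_range.1 hj
    have hl' : (l : ℝ) < M := by exact_mod_cast Finset.mem_range.1 hl
    have := Nat.cast_nonneg (α := ℝ) j
    have := Nat.cast_nonneg (α := ℝ) l
    rw [abs_le]
    constructor <;> linarith
  have h2 : (0 : ℝ) < a i := by exact_mod_cast ha i
  simp only [Pi.smul_apply, smul_eq_mul, Int.cast_mul, Int.cast_sub, Int.cast_natCast, abs_mul,
    abs_of_pos h2]
  exact mul_le_mul_of_nonneg_right h1 h2.le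

theorem ev_fejer (M : ℕ) (a : Fin d → ℤ) (x : Fin d → ℝ) :
    ev (fejer M a) x =
      (((M : ℝ)⁻¹ * ‖∑ j ∈ Finset.range M, torusChar ((j : ℤ) • a) x‖ ^ 2 : ℝ) : ℂ) := by
  have h : ∀ j l : ℕ, torusChar (((j : ℤ) - l) • a) x =
      torusChar ((j : ℤ) • a) x * (starRingEnd ℂ) (torusChar ((l : ℤ) • a) x) := by
    intro j l
    rw [← torusChar_neg, ← torusChar_add, sub_smul, sub_eq_add_neg]
  rw [fejer, map_smul, map_sum]
  simp only [map_sum, Pi.smul_apply, Finset.sum_apply, ev_ch, smul_eq_mul, h]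
  push_cast
  rw [← Complex.mul_conj', map_sum, Finset.sum_mul_sum]

theorem coeff_zero_ch_zsmul {a : Fin d → ℤ} (ha : a ≠ 0) (m : ℤ) :
    (ch (m • a) : TrigPoly d).coeff 0 = if m = 0 then 1 else 0 := by
  by_cases hm : m = 0
  · subst hm; simp
  · have : m • a ≠ 0 := smul_ne_zero hm ha
    rw [coeff_ch_of_ne this, if_neg hm]

theorem coeff_zero_fejer {M : ℕ} (hM : M ≠ 0) {a : Fin d → ℤ} (ha : a ≠ 0) :
    (fejer M a).coeff 0 = 1 := by
  have h : ∀ j ∈ Finset.range M, ∑ l ∈ Finset.range M,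
      (ch (((j : ℤ) - l) • a) : TrigPoly d).coeff 0 = 1 := by
    intro j hj
    rw [Finset.sum_eq_single j]
    · simp
    · intro l _ hl
      rw [coeff_zero_ch_zsmul ha, if_neg]
      omega
    · intro h; exact absurd hj h
  simp only [fejer, AddMonoidAlgebra.coeff_smul, AddMonoidAlgebra.coeff_sum, Finsupp.smul_apply,
    Finsupp.finsetSum_apply]
  rw [Finset.sum_congr rfl h]
  simp [hM]

/-- Only the pairs with `l = j + 1` contribute; there are `M - 1` of them, each of weight `1 / M`.
-/
theorem coeff_zero_fejer_mul_ch {M : ℕ} (hM : M ≠ 0) {a : Fin d → ℤ} (ha : a ≠ 0) :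
    (fejer M a * ch a).coeff 0 = 1 - (M : ℂ)⁻¹ := by
  obtain ⟨n, rfl⟩ := Nat.exists_eq_succ_of_ne_zero hM
  have e : ∀ j l : ℕ, (ch (((j : ℤ) - l) • a) : TrigPoly d) * ch a =
      ch (((j : ℤ) - l + 1) • a) := by
    intro j l
    rw [AddMonoidAlgebra.single_mul_single, add_smul _ (1 : ℤ), one_smul, mul_one]
  have h : ∀ j ∈ Finset.range n, ∑ l ∈ Finset.range (n + 1),
      (ch (((j : ℤ) - l + 1) • a) : TrigPoly d).coeff 0 = 1 := by
    intro j hj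
    rw [Finset.sum_eq_single (j + 1)]
    · rw [coeff_zero_ch_zsmul ha, if_pos]
      push_cast; ring
    · intro l _ hl
      rw [coeff_zero_ch_zsmul ha, if_neg]
      omega
    · intro h
      simp only [Finset.mem_range] at h hj
      omega
  -- The last row `j = n` would need `l = n + 1`, which is out of range.
  have h' : ∑ l ∈ Finset.range (n + 1),
      (ch (((n : ℤ) - l + 1) • a) : TrigPoly d).coeff 0 = 0 := by
    refine Finset.sum_eq_zero fun l hl => ?_
    rw [coeff_zero_ch_zsmul ha, if_neg]
    simp only [Finset.mem_range] at hl
    omega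
  simp only [fejer, smul_mul_assoc, Finset.sum_mul, e, AddMonoidAlgebra.coeff_smul,
    AddMonoidAlgebra.coeff_sum, Finsupp.smul_apply, Finsupp.finsetSum_apply]
  rw [Finset.sum_range_succ, h', Finset.sum_congr rfl h]
  have : (n : ℂ) + 1 ≠ 0 := by exact_mod_cast Nat.succ_ne_zero n
  simp
  field_simp
  ring

theorem coeff_zero_fejer_mul_ch_neg {M : ℕ} (hM : M ≠ 0) {a : Fin d → ℤ} (ha : a ≠ 0) :
    (fejer M a * ch (-a)).coeff 0 = 1 - (M : ℂ)⁻¹ := by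
  have e : fejer M (-a) = fejer M a := by
    rw [fejer, fejer, Finset.sum_comm]
    congr 1
    refine Finset.sum_congr rfl fun j _ => Finset.sum_congr rfl fun l _ => ?_
    rw [smul_neg, ← neg_smul, neg_sub]
  rw [← e]
  exact coeff_zero_fejer_mul_ch hM (neg_ne_zero.2 ha)

/-! ### Riesz products of Fejér kernels -/

/-- The product of the Fejér kernels of orders `M 0, M 1, …` in the frequencies `a 0, a 1, …`. -/
def riesz (a : ℕ → Fin d → ℤ) (M : ℕ → ℕ) (k : ℕ) : TrigPoly d :=
  ∏ j ∈ Finset.range k, fejer (M j) (a j)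

/-- A bound for the frequencies of `riesz a M k`, with room for Bernstein estimates. -/
def scale (a : ℕ → Fin d → ℤ) (M : ℕ → ℕ) : ℕ → Fin d → ℝ
  | 0 => 0
  | k + 1 => fun i => M k * (M k * (a k i : ℝ) + scale a M k i)

/-- The frequencies `a` increase rapidly in comparison with the orders `M`. -/
structure Lacunary (a : ℕ → Fin d → ℤ) (M : ℕ → ℕ) (δ : ℝ) : Prop where
  pos : ∀ k i, 0 < a k i
  two_le : ∀ k, 2 ≤ M k
  scale_le : ∀ k i, scale a M k i ≤ δ * a k i

variable {a : ℕ → Fin d → ℤ} {M : ℕ → ℕ} {δ : ℝ}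

theorem Lacunary.scale_nonneg (h : Lacunary a M δ) (k : ℕ) (i : Fin d) : 0 ≤ scale a M k i := by
  induction k with
  | zero => simp [scale]
  | succ k ih =>
    have : (0 : ℝ) < a k i := by exact_mod_cast h.pos k i
    simp only [scale]
    positivity

theorem Lacunary.add_le_scale_succ (h : Lacunary a M δ) (k : ℕ) (i : Fin d) :
    M k * (a k i : ℝ) + scale a M k i ≤ scale a M (k + 1) i := by
  have h1 : (0 : ℝ) < a k i := by exact_mod_cast h.pos k i
  have h2 := h.scale_nonneg k i
  have h3 : (1 : ℝ) ≤ M k := by exact_mod_cast (h.two_le k).trans' one_le_two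
  simp only [scale]
  exact le_mul_of_one_le_left (by positivity) h3

theorem Lacunary.scale_mono (h : Lacunary a M δ) (i : Fin d) :
    Monotone fun k => scale a M k i := by
  refine monotone_nat_of_le_succ fun k => ?_
  have h1 : (0 : ℝ) < a k i := by exact_mod_cast h.pos k i
  refine le_trans ?_ (h.add_le_scale_succ k i)
  have : 0 ≤ M k * (a k i : ℝ) := by positivity
  linarith

theorem Lacunary.ne_zero (h : Lacunary a M δ) (i : Fin d) (k : ℕ) : a k ≠ 0 := fun h0 => by
  have := h.pos k i
  simp [h0] at this

theorem riesz_succ (k : ℕ) : riesz a M (k + 1) = riesz a M k * fejer (M k) (a k) :=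
  Finset.prod_range_succ _ _

theorem Lacunary.degLE_riesz (h : Lacunary a M δ) (k : ℕ) :
    DegLE (scale a M k) (riesz a M k) := by
  induction k with
  | zero => simpa [riesz] using degLE_one fun i => (h.scale_nonneg 0 i)
  | succ k ih =>
    rw [riesz_succ]
    refine (ih.mul (degLE_fejer (M k) (h.pos k))).mono fun i => ?_
    rw [add_comm]
    exact h.add_le_scale_succ k i

/-- Supplies the degree hypothesis of `coeff_zero_mul`; the factor 3 leaves room for products of
several polynomials of degree at most `scale a M k`. -/
theorem Lacunary.lt_of_le_mul_scale (h : Lacunary a M δ) (hδ : δ ≤ 1 / 4) {k : ℕ} {i : Fin d}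
    {ρ : ℝ} (hρ : ρ ≤ 3 * scale a M k i) : ρ < a k i := by
  have h1 : (0 : ℝ) < a k i := by exact_mod_cast h.pos k i
  have h2 := h.scale_le k i
  nlinarith

theorem Lacunary.coeff_zero_riesz (h : Lacunary a M δ) (hδ : δ ≤ 1 / 4) (i : Fin d) (k : ℕ) :
    (riesz a M k).coeff 0 = 1 := by
  induction k with
  | zero => simp [riesz, AddMonoidAlgebra.one_def]
  | succ k ih =>
    have := h.scale_nonneg k i
    rw [riesz_succ, coeff_zero_mul i (h.degLE_riesz k) (ray_fejer _ _)
      (h.lt_of_le_mul_scale hδ (by linarith)), ih,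
      coeff_zero_fejer (by have := h.two_le k; omega) (h.ne_zero i k), mul_one]

theorem Lacunary.nrm_riesz (h : Lacunary a M δ) (hδ : δ ≤ 1 / 4) (i : Fin d) (k : ℕ) :
    nrm (riesz a M k) = 1 := by
  have := nrm_eq_of_nonneg (riesz a M k) (fun x => ∏ j ∈ Finset.range k,
    ((M j : ℝ)⁻¹ * ‖∑ l ∈ Finset.range (M j), torusChar ((l : ℤ) • a j) x‖ ^ 2))
    (fun x => Finset.prod_nonneg fun j _ => by positivity) fun x => by
      rw [riesz, map_prod, Finset.prod_apply, Complex.ofReal_prod]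
      exact Finset.prod_congr rfl fun j _ => ev_fejer _ _ _
  rw [h.coeff_zero_riesz hδ i] at this
  exact_mod_cast this

theorem mono_le_mul_mono {x : Fin d → ℝ} (hx : ∀ i, 0 ≤ x i) {c : ℝ} (hc : 1 ≤ c)
    {γ : Fin d → ℕ} (hγ : γ ≠ 0) : c * mono x γ ≤ mono (fun i => c * x i) γ := by
  rw [mono_smul]
  refine mul_le_mul_of_nonneg_right (le_self_pow₀ hc fun h => hγ ?_) (mono_nonneg hx γ)
  funext i
  exact (Finset.sum_eq_zero_iff.1 h) i (Finset.mem_univ i)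

/-- Expanding the last kernel into `M k ^ 2` characters of weight `1 / M k` loses a factor `M k`.
For `γ ≠ 0` the outer factor `M k` in `scale` absorbs it; for `γ = 0` positivity gives the norm
exactly. The constant therefore stays 1 for all `k`. -/
theorem Lacunary.bernstein_riesz (h : Lacunary a M δ) (hδ : δ ≤ 1 / 4) (i : Fin d) (k : ℕ) :
    Bernstein 1 (scale a M k) (riesz a M k) := by
  induction k with
  | zero =>
    intro γ
    by_cases hγ : γ = 0
    · subst hγ
      rw [D_zero, mono_zero, h.nrm_riesz hδ i, mul_one]
    · obtain ⟨j, hj⟩ := Function.ne_iff.1 hγ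
      have : D γ (riesz a M 0) = 0 := by
        simp only [riesz, Finset.range_zero, Finset.prod_empty, AddMonoidAlgebra.one_def,
          mult_single]
        rw [symb, Finset.prod_eq_zero (Finset.mem_univ j) (by simpa using hj)]
        simp
      rw [this, nrm_zero, one_mul]
      exact mono_nonneg (fun i => h.scale_nonneg 0 i) γ
  | succ k ih =>
    intro γ
    by_cases hγ : γ = 0
    · subst hγ
      rw [D_zero, mono_zero, h.nrm_riesz hδ i, mul_one]
    have hM : (2 : ℝ) ≤ M k := by exact_mod_cast h.two_le k
    have hnn : ∀ i, 0 ≤ M k * (a k i : ℝ) + scale a M k i := fun i => by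
      have h1 : (0 : ℝ) < a k i := by exact_mod_cast h.pos k i
      have h2 := h.scale_nonneg k i
      positivity
    have hterm : ∀ j ∈ Finset.range (M k), ∀ l ∈ Finset.range (M k),
        nrm (D γ (ch (((j : ℤ) - l) • a k) * riesz a M k)) ≤
          mono (fun i => M k * (a k i : ℝ) + scale a M k i) γ := by
      intro j hj l hl
      refine (nrm_D_ch_mul_le ih _ γ).trans ?_
      rw [one_mul]
      refine mono_le_mono (fun i => add_nonneg (abs_nonneg _) (h.scale_nonneg k i)) (fun i => ?_) γ
      have h1 : |((j : ℝ) - l)| ≤ M k := by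
        have hj' : (j : ℝ) < M k := by exact_mod_cast Finset.mem_range.1 hj
        have hl' : (l : ℝ) < M k := by exact_mod_cast Finset.mem_range.1 hl
        have := Nat.cast_nonneg (α := ℝ) j
        have := Nat.cast_nonneg (α := ℝ) l
        rw [abs_le]
        constructor <;> linarith
      have h2 : (0 : ℝ) < a k i := by exact_mod_cast h.pos k i
      simp only [Pi.smul_apply, smul_eq_mul, Int.cast_mul, Int.cast_sub, Int.cast_natCast, abs_mul,
        abs_of_pos h2]
      have := mul_le_mul_of_nonneg_right h1 h2.le
      linarith
    have e : D γ (riesz a M (k + 1)) = (M k : ℂ)⁻¹ • ∑ j ∈ Finset.range (M k),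
        ∑ l ∈ Finset.range (M k), D γ (ch (((j : ℤ) - l) • a k) * riesz a M k) := by
      rw [riesz_succ, mul_comm, fejer, smul_mul_assoc, map_smul, Finset.sum_mul, map_sum]
      simp only [Finset.sum_mul, map_sum]
    rw [e, nrm_smul, one_mul]
    have hsum : nrm (∑ j ∈ Finset.range (M k),
        ∑ l ∈ Finset.range (M k), D γ (ch (((j : ℤ) - l) • a k) * riesz a M k)) ≤
        M k * (M k * mono (fun i => M k * (a k i : ℝ) + scale a M k i) γ) := by
      refine (nrm_sum_le _ _).trans ((Finset.sum_le_card_nsmul _ _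
        (M k * mono (fun i => M k * (a k i : ℝ) + scale a M k i) γ) fun j hj => ?_).trans_eq
          (by simp))
      exact (nrm_sum_le _ _).trans ((Finset.sum_le_card_nsmul _ _ _ (hterm j hj)).trans_eq
        (by simp))
    have hfin := mono_le_mul_mono hnn (c := M k) (by linarith) hγ
    rw [norm_inv, Complex.norm_natCast]
    calc (M k : ℝ)⁻¹ * _ ≤ (M k : ℝ)⁻¹ *
          (M k * (M k * mono (fun i => M k * (a k i : ℝ) + scale a M k i) γ)) :=
          mul_le_mul_of_nonneg_left hsum (by positivity)
      _ = M k * mono (fun i => M k * (a k i : ℝ) + scale a M k i) γ := by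
          rw [← mul_assoc, inv_mul_cancel₀ (by positivity), one_mul]
      _ ≤ _ := hfin

end

section

variable {d : ℕ} {a : ℕ → Fin d → ℤ} {M : ℕ → ℕ} {δ : ℝ}

/-! ### The extremal polynomial -/

/-- Approximate `D^α`-primitive of `riesz (k + 1) - riesz k`. -/
def block (α : Fin d → ℕ) (a : ℕ → Fin d → ℤ) (M : ℕ → ℕ) (k : ℕ) : TrigPoly d :=
  (M k : ℂ)⁻¹ • ∑ p ∈ (Finset.range (M k)).offDiag,
    (symb α (((p.1 : ℤ) - p.2) • a k))⁻¹ • (ch (((p.1 : ℤ) - p.2) • a k) * riesz a M k)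

/-- The leading part of `D^γ (block α a M k)`. -/
def leading (γ α : Fin d → ℕ) (a : ℕ → Fin d → ℤ) (M : ℕ → ℕ) (k : ℕ) : TrigPoly d :=
  (M k : ℂ)⁻¹ • ∑ p ∈ (Finset.range (M k)).offDiag,
    (symb γ (((p.1 : ℤ) - p.2) • a k) / symb α (((p.1 : ℤ) - p.2) • a k)) •
      (ch (((p.1 : ℤ) - p.2) • a k) * riesz a M k)

/-- The modulus of the symbol of `D^γ / D^α` at the frequency `q`. -/
def ratio (γ α : Fin d → ℕ) (q : Fin d → ℤ) : ℝ :=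
  mono (fun i => |(q i : ℝ)|) γ / mono (fun i => |(q i : ℝ)|) α

theorem ratio_nonneg (γ α : Fin d → ℕ) (q : Fin d → ℤ) : 0 ≤ ratio γ α q :=
  div_nonneg (mono_nonneg (fun _ => abs_nonneg _) _) (mono_nonneg (fun _ => abs_nonneg _) _)

theorem one_add_pow_le_of_le_one {δ : ℝ} (h0 : 0 ≤ δ) (h1 : δ ≤ 1) (n : ℕ) :
    (1 + δ) ^ n ≤ 1 + (2 ^ n - 1) * δ := by
  induction n with
  | zero => simp
  | succ n ih =>
    have h2 : (1 : ℝ) ≤ 2 ^ n := one_le_pow₀ (by norm_num)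
    have h3 : (2 ^ n - 1) * (δ * δ) ≤ (2 ^ n - 1) * (δ * 1) :=
      mul_le_mul_of_nonneg_left (mul_le_mul_of_nonneg_left h1 h0) (by linarith)
    rw [pow_succ, pow_succ]
    nlinarith

theorem mono_add_sub_mono_le {x A : Fin d → ℝ} (hx : ∀ i, 0 ≤ x i) (hA : ∀ i, 0 ≤ A i)
    (h0 : 0 ≤ δ) (h1 : δ ≤ 1) (hxA : ∀ i, A i ≤ δ * x i) (γ : Fin d → ℕ) {n : ℕ}
    (hn : ∑ i, γ i ≤ n) :
    mono (fun i => x i + A i) γ - mono x γ ≤ 2 ^ n * δ * mono x γ := by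
  have h2 : mono (fun i => x i + A i) γ ≤ mono (fun i => (1 + δ) * x i) γ :=
    mono_le_mono (fun i => add_nonneg (hx i) (hA i)) (fun i => by linarith [hxA i]) γ
  rw [mono_smul] at h2
  have h3 := mono_nonneg hx γ
  have h4 : (1 + δ) ^ (∑ i, γ i) ≤ (1 + δ) ^ n := pow_le_pow_right₀ (by linarith) hn
  have h5 := one_add_pow_le_of_le_one h0 h1 n
  have h6 : (1 + δ) ^ (∑ i, γ i) * mono x γ ≤ (1 + 2 ^ n * δ) * mono x γ :=
    mul_le_mul_of_nonneg_right (by linarith) h3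
  linarith

/-- The numerator gains a power of `|z|` of exponent at most `n`; the gain of the denominator is at
least 1 and is dropped. -/
theorem ratio_zsmul_le {q : Fin d → ℤ} (hq : ∀ i, 0 < q i) {γ : Fin d → ℕ} (α : Fin d → ℕ) {n m : ℕ}
    (hn : ∑ i, γ i ≤ n) {z : ℤ} (hz : z ≠ 0) (hzm : |z| ≤ m) :
    ratio γ α (z • q) ≤ m ^ n * ratio γ α q := by
  have e : (fun i => |((z • q) i : ℝ)|) = fun i => |(z : ℝ)| * |(q i : ℝ)| := by
    funext i
    simp [abs_mul]
  have h1 : (1 : ℝ) ≤ |(z : ℝ)| := by exact_mod_cast Int.one_le_abs hz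
  have h2 : |(z : ℝ)| ≤ m := by exact_mod_cast hzm
  have hpos : ∀ i, 0 < |(q i : ℝ)| := fun i => abs_pos.2 (by exact_mod_cast (hq i).ne')
  rw [ratio, e, mono_smul, mono_smul, mul_div_mul_comm]
  refine mul_le_mul_of_nonneg_right ?_ (ratio_nonneg γ α q)
  refine (div_le_self (by positivity) (one_le_pow₀ h1)).trans ?_
  exact (pow_le_pow_right₀ h1 hn).trans (pow_le_pow_left₀ (by positivity) h2 n)

theorem ratio_self {q : Fin d → ℤ} (hq : ∀ i, q i ≠ 0) (α : Fin d → ℕ) : ratio α α q = 1 :=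
  div_self (mono_pos (fun i => abs_pos.2 (by exact_mod_cast hq i)) α).ne'

theorem symb_ne_zero {q : Fin d → ℤ} (hq : ∀ i, q i ≠ 0) (α : Fin d → ℕ) : symb α q ≠ 0 :=
  Finset.prod_ne_zero_iff.2 fun i _ => pow_ne_zero _ (by simpa using hq i)

theorem norm_symb_div (γ α : Fin d → ℕ) (q : Fin d → ℤ) :
    ‖symb γ q / symb α q‖ = ratio γ α q := by
  rw [norm_div, norm_symb, norm_symb, ratio]

/-- Power count: at most `m ^ 2` terms, divided by `m`. -/
theorem nrm_offDiag_le {m n : ℕ} {F : ℕ × ℕ → TrigPoly d} {c : ℝ} (hc : 0 ≤ c)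
    (hF : ∀ p ∈ (Finset.range m).offDiag, nrm (F p) ≤ m ^ n * c) :
    nrm ((m : ℂ)⁻¹ • ∑ p ∈ (Finset.range m).offDiag, F p) ≤ m ^ (n + 1) * c := by
  rw [nrm_smul, norm_inv, Complex.norm_natCast]
  have h1 : nrm (∑ p ∈ (Finset.range m).offDiag, F p) ≤ m * m * (m ^ n * c) := by
    refine (nrm_sum_le _ _).trans ((Finset.sum_le_card_nsmul _ _ _ hF).trans ?_)
    rw [nsmul_eq_mul]
    refine mul_le_mul_of_nonneg_right ?_ (by positivity)
    rw [Finset.offDiag_card, Finset.card_range]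
    exact_mod_cast Nat.sub_le _ _
  rcases eq_or_ne m 0 with rfl | hm
  · simp
  · refine (mul_le_mul_of_nonneg_left h1 (by positivity)).trans_eq ?_
    field_simp
    ring

theorem sub_ne_zero_of_mem_offDiag {m : ℕ} {p : ℕ × ℕ} (hp : p ∈ (Finset.range m).offDiag) :
    (p.1 : ℤ) - p.2 ≠ 0 := by
  have := (Finset.mem_offDiag.1 hp).2.2
  omega

theorem abs_sub_le_of_mem_offDiag {m : ℕ} {p : ℕ × ℕ} (hp : p ∈ (Finset.range m).offDiag) :
    |(p.1 : ℤ) - p.2| ≤ m := by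
  obtain ⟨h1, h2, -⟩ := Finset.mem_offDiag.1 hp
  rw [Finset.mem_range] at h1 h2
  rw [abs_le]
  omega

theorem Lacunary.nrm_leading_le (h : Lacunary a M δ) (hδ : δ ≤ 1 / 4) (i : Fin d)
    {γ : Fin d → ℕ} (α : Fin d → ℕ) {n : ℕ} (hn : ∑ i, γ i ≤ n) (k : ℕ) :
    nrm (leading γ α a M k) ≤ M k ^ (n + 1) * ratio γ α (a k) := by
  refine nrm_offDiag_le (ratio_nonneg _ _ _) fun p hp => ?_
  rw [nrm_smul, nrm_ch_mul, h.nrm_riesz hδ i, mul_one, norm_symb_div]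
  exact ratio_zsmul_le (h.pos k) α hn (sub_ne_zero_of_mem_offDiag hp)
    (abs_sub_le_of_mem_offDiag hp)

/-- The leading part differentiates only the characters `z • a k`. Derivatives falling on the Riesz
product cost `scale a M k`, which lacunarity makes a fraction `δ` of the frequency, so the error has
relative size `δ`. -/
theorem Lacunary.nrm_D_block_sub_leading_le (h : Lacunary a M δ) (h0 : 0 ≤ δ) (hδ : δ ≤ 1 / 4)
    (i : Fin d) {γ : Fin d → ℕ} (α : Fin d → ℕ) {n : ℕ} (hn : ∑ i, γ i ≤ n) (k : ℕ) :
    nrm (D γ (block α a M k) - leading γ α a M k) ≤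
      M k ^ (n + 1) * (2 ^ n * δ * ratio γ α (a k)) := by
  have e : D γ (block α a M k) - leading γ α a M k =
      (M k : ℂ)⁻¹ • ∑ p ∈ (Finset.range (M k)).offDiag,
        (symb α (((p.1 : ℤ) - p.2) • a k))⁻¹ •
          (D γ (ch (((p.1 : ℤ) - p.2) • a k) * riesz a M k) -
            symb γ (((p.1 : ℤ) - p.2) • a k) •
              (ch (((p.1 : ℤ) - p.2) • a k) * riesz a M k)) := by
    rw [block, leading, map_smul, ← smul_sub, map_sum, ← Finset.sum_sub_distrib]
    congr 1
    refine Finset.sum_congr rfl fun p _ => ?_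
    rw [map_smul, smul_sub, smul_smul, div_eq_inv_mul]
  rw [e]
  have hr := ratio_nonneg γ α (a k)
  refine nrm_offDiag_le (by positivity) fun p hp => ?_
  set z : ℤ := (p.1 : ℤ) - p.2 with hz
  have hz0 : z ≠ 0 := sub_ne_zero_of_mem_offDiag hp
  have h1 := nrm_D_ch_mul_sub_le (h.bernstein_riesz hδ i k) (z • a k) γ
  rw [one_mul] at h1
  have h2 := mono_add_sub_mono_le (x := fun i => |((z • a k) i : ℝ)|) (A := scale a M k)
    (fun i => abs_nonneg _) (h.scale_nonneg k) h0 (by linarith) (fun i => by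
      refine (h.scale_le k i).trans (mul_le_mul_of_nonneg_left ?_ h0)
      have h3 : (1 : ℝ) ≤ |(z : ℝ)| := by exact_mod_cast Int.one_le_abs hz0
      simp only [Pi.smul_apply, smul_eq_mul, Int.cast_mul, abs_mul]
      exact (le_abs_self _).trans (le_mul_of_one_le_left (abs_nonneg _) h3)) γ hn
  have h4 := ratio_zsmul_le (h.pos k) α hn hz0 (abs_sub_le_of_mem_offDiag hp)
  have h5 : 0 ≤ mono (fun i => |((z • a k) i : ℝ)|) α := mono_nonneg (fun _ => abs_nonneg _) α
  rw [nrm_smul, norm_inv, norm_symb]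
  calc _ ≤ (mono (fun i => |((z • a k) i : ℝ)|) α)⁻¹ *
        (2 ^ n * δ * mono (fun i => |((z • a k) i : ℝ)|) γ) :=
        mul_le_mul_of_nonneg_left (h1.trans h2) (inv_nonneg.2 h5)
    _ = 2 ^ n * δ * ratio γ α (z • a k) := by rw [ratio]; ring
    _ ≤ 2 ^ n * δ * (M k ^ n * ratio γ α (a k)) :=
        mul_le_mul_of_nonneg_left h4 (by positivity)
    _ = _ := by ring

theorem Lacunary.nrm_D_block_le (h : Lacunary a M δ) (h0 : 0 ≤ δ) (hδ : δ ≤ 1 / 4)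
    (i : Fin d) {γ : Fin d → ℕ} (α : Fin d → ℕ) {n : ℕ} (hn : ∑ i, γ i ≤ n)
    (hδn : 2 ^ n * δ ≤ 1) (k : ℕ) :
    nrm (D γ (block α a M k)) ≤ 2 * (M k ^ (n + 1) * ratio γ α (a k)) := by
  have h1 := h.nrm_leading_le hδ i α hn k
  have h2 := h.nrm_D_block_sub_leading_le h0 hδ i α hn k
  have h3 := nrm_add_le (D γ (block α a M k) - leading γ α a M k) (leading γ α a M k)
  rw [sub_add_cancel] at h3
  have hr := ratio_nonneg γ α (a k)
  have h4 : (M k : ℝ) ^ (n + 1) * (2 ^ n * δ * ratio γ α (a k)) ≤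
      M k ^ (n + 1) * (1 * ratio γ α (a k)) := by gcongr
  linarith

/-- The diagonal pairs of the Fejér kernel contribute exactly `riesz a M k`; removing them from
`riesz a M (k + 1)` leaves the off-diagonal sum. -/
theorem Lacunary.leading_self (h : Lacunary a M δ) (α : Fin d → ℕ) (k : ℕ) :
    leading α α a M k = riesz a M (k + 1) - riesz a M k := by
  have hM : (M k : ℂ) ≠ 0 := by
    have := h.two_le k
    exact_mod_cast (by omega : M k ≠ 0)
  have e : ∑ p ∈ (Finset.range (M k)).offDiag,
      (symb α (((p.1 : ℤ) - p.2) • a k) / symb α (((p.1 : ℤ) - p.2) • a k)) •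
      (ch (((p.1 : ℤ) - p.2) • a k) * riesz a M k) =
      ∑ p ∈ (Finset.range (M k)).offDiag, ch (((p.1 : ℤ) - p.2) • a k) * riesz a M k := by
    refine Finset.sum_congr rfl fun p hp => ?_
    rw [div_self, one_smul]
    refine symb_ne_zero (fun i => ?_) α
    simp only [Pi.smul_apply, smul_eq_mul]
    exact mul_ne_zero (sub_ne_zero_of_mem_offDiag hp) (h.pos k i).ne'
  have hdiag : ∑ p ∈ (Finset.range (M k)).diag, ch (((p.1 : ℤ) - p.2) • a k) * riesz a M k =
      (M k : ℂ) • riesz a M k := by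
    rw [Finset.sum_diag]
    simp only [sub_self, zero_smul, ← AddMonoidAlgebra.one_def, one_mul, Finset.sum_const,
      Finset.card_range]
    exact (Nat.cast_smul_eq_nsmul ℂ _ _).symm
  have hprod : ∑ p ∈ (Finset.range (M k)) ×ˢ (Finset.range (M k)),
      ch (((p.1 : ℤ) - p.2) • a k) * riesz a M k = (M k : ℂ) • riesz a M (k + 1) := by
    rw [riesz_succ, fejer, Finset.sum_product, mul_smul_comm, smul_smul, mul_inv_cancel₀ hM,
      one_smul, mul_comm, Finset.sum_mul]
    simp only [Finset.sum_mul]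
  rw [← Finset.diag_union_offDiag, Finset.sum_union (Finset.disjoint_diag_offDiag _), hdiag]
    at hprod
  rw [leading, e, eq_sub_of_add_eq' hprod, ← smul_sub, smul_smul,
    inv_mul_cancel₀ hM, one_smul]

theorem Lacunary.degLE_block (h : Lacunary a M δ) (α : Fin d → ℕ) (k : ℕ) :
    DegLE (scale a M (k + 1)) (block α a M k) := by
  refine (DegLE.sum fun p hp => (((degLE_ch fun i => ?_).mul (h.degLE_riesz k)).mono
    (h.add_le_scale_succ k)).smul _).smul _
  have h1 : |((p.1 : ℝ) - p.2)| ≤ M k := by exact_mod_cast abs_sub_le_of_mem_offDiag hp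
  have h2 : (0 : ℝ) < a k i := by exact_mod_cast h.pos k i
  simp only [Pi.smul_apply, smul_eq_mul, Int.cast_mul, Int.cast_sub, Int.cast_natCast, abs_mul,
    abs_of_pos h2]
  exact mul_le_mul_of_nonneg_right h1 h2.le

/-! ### The test function -/

/-- `(1 + cos ⟨q, x⟩) / 2`. -/
def halfCos (q : Fin d → ℤ) : TrigPoly d :=
  (1 / 2 : ℂ) • 1 + (1 / 4 : ℂ) • (ch q + ch (-q))

theorem ev_halfCos (q : Fin d → ℤ) (x : Fin d → ℝ) :
    ev (halfCos q) x = (((1 + (torusChar q x).re) / 2 : ℝ) : ℂ) := by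
  have h := Complex.add_conj (torusChar q x)
  simp only [halfCos, map_add, map_smul, map_one, Pi.add_apply, Pi.smul_apply, Pi.one_apply, ev_ch,
    torusChar_neg, h, smul_eq_mul]
  push_cast
  ring

theorem ray_halfCos (q : Fin d → ℤ) : Ray q (halfCos q) :=
  ((ray_one q).smul _).add (((ray_ch q).add (ray_ch_neg q)).smul _)

theorem degLE_halfCos {q : Fin d → ℤ} (hq : ∀ i, 0 < q i) :
    DegLE (fun i => (q i : ℝ)) (halfCos q) := by
  have h : ∀ i, (0 : ℝ) < q i := fun i => by exact_mod_cast hq i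
  refine ((degLE_one fun i => (h i).le).smul _).add
    (((degLE_ch fun i => ?_).add (degLE_ch fun i => ?_)).smul _)
  · rw [abs_of_pos (h i)]
  · rw [Pi.neg_apply, Int.cast_neg, abs_neg, abs_of_pos (h i)]

theorem coeff_zero_one : (1 : TrigPoly d).coeff 0 = 1 := by
  simp [AddMonoidAlgebra.one_def]

theorem coeff_zero_one_sub_halfCos {q : Fin d → ℤ} (hq : q ≠ 0) :
    ((1 : TrigPoly d) - halfCos q).coeff 0 = 1 / 2 := by
  simp only [halfCos, AddMonoidAlgebra.coeff_sub, AddMonoidAlgebra.coeff_add,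
    AddMonoidAlgebra.coeff_smul, Finsupp.sub_apply, Finsupp.add_apply, Finsupp.smul_apply,
    coeff_zero_one, coeff_ch_of_ne hq, coeff_ch_of_ne (neg_ne_zero.2 hq)]
  norm_num

/-- The kernel concentrates where `halfCos q` is close to 1, so inserting this factor costs only a
relative `1 / (2 * m)`. -/
theorem coeff_zero_fejer_mul_halfCos {m : ℕ} (hm : m ≠ 0) {q : Fin d → ℤ} (hq : q ≠ 0) :
    (fejer m q * halfCos q).coeff 0 = 1 - (2 * m : ℂ)⁻¹ := by
  rw [halfCos, mul_add, mul_smul_comm, mul_smul_comm, mul_add, mul_one]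
  simp only [AddMonoidAlgebra.coeff_add, AddMonoidAlgebra.coeff_smul, Finsupp.add_apply,
    Finsupp.smul_apply, coeff_zero_fejer hm hq, coeff_zero_fejer_mul_ch hm hq,
    coeff_zero_fejer_mul_ch_neg hm hq, smul_eq_mul, mul_inv]
  ring

/-- The product of the functions `(1 + cos ⟨a (2 i + 1), x⟩) / 2` for `i < j`. -/
def cutoff (a : ℕ → Fin d → ℤ) (j : ℕ) : TrigPoly d :=
  ∏ i ∈ Finset.range j, halfCos (a (2 * i + 1))

/-- The summand of the test function that detects the frequency `a (2 j)`. -/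
def detector (a : ℕ → Fin d → ℤ) (j : ℕ) : TrigPoly d :=
  ch (-a (2 * j)) * (cutoff a j * (1 - halfCos (a (2 * j + 1))))

theorem sum_prod_mul_one_sub {t : ℕ → ℝ} (n : ℕ) :
    ∑ j ∈ Finset.range n, (∏ i ∈ Finset.range j, t i) * (1 - t j) =
      1 - ∏ i ∈ Finset.range n, t i := by
  induction n with
  | zero => simp
  | succ n ih => rw [Finset.sum_range_succ, ih, Finset.prod_range_succ]; ring

/-- The characters are unimodular, and their weights `t 0 ⋯ t (j-1) (1 - t j)` with `t i ∈ [0, 1]`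
break a stick of length 1. -/
theorem norm_ev_sum_detector_le (a : ℕ → Fin d → ℤ) (n : ℕ) (x : Fin d → ℝ) :
    ‖ev (∑ j ∈ Finset.range n, detector a j) x‖ ≤ 1 := by
  set t : ℕ → ℝ := fun i => (1 + (torusChar (a (2 * i + 1)) x).re) / 2 with ht
  have ht0 : ∀ i, 0 ≤ t i ∧ t i ≤ 1 := fun i => by
    have h := Complex.abs_re_le_norm (torusChar (a (2 * i + 1)) x)
    rw [norm_torusChar, abs_le] at h
    constructor <;> simp only [ht] <;> linarith [h.1, h.2]
  have e : ∀ j, ‖ev (detector a j) x‖ = (∏ i ∈ Finset.range j, t i) * (1 - t j) := fun j => by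
    rw [detector, cutoff, map_mul, map_mul, map_sub, map_prod, map_one]
    simp only [Pi.mul_apply, Pi.sub_apply, Finset.prod_apply, Pi.one_apply, ev_ch, ev_halfCos,
      norm_mul, norm_torusChar, one_mul, norm_prod]
    congr 1
    · exact Finset.prod_congr rfl fun i _ => by
        rw [Complex.norm_real, Real.norm_of_nonneg (ht0 i).1]
    · rw [← Complex.ofReal_one, ← Complex.ofReal_sub, Complex.norm_real,
        Real.norm_of_nonneg (sub_nonneg.2 (ht0 j).2)]
  rw [map_sum, Finset.sum_apply]
  refine (norm_sum_le _ _).trans ?_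
  simp only [e, sum_prod_mul_one_sub]
  have := Finset.prod_nonneg fun i (_ : i ∈ Finset.range n) => (ht0 i).1
  linarith

theorem Lacunary.le_scale_succ (h : Lacunary a M δ) (k : ℕ) (i : Fin d) :
    (a k i : ℝ) + scale a M k i ≤ scale a M (k + 1) i := by
  have h1 : (0 : ℝ) < a k i := by exact_mod_cast h.pos k i
  have h3 : (1 : ℝ) ≤ M k := by exact_mod_cast (h.two_le k).trans' one_le_two
  have := h.add_le_scale_succ k i
  nlinarith

theorem Lacunary.degLE_cutoff (h : Lacunary a M δ) (j : ℕ) :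
    DegLE (scale a M (2 * j)) (cutoff a j) := by
  induction j with
  | zero => simpa [cutoff] using degLE_one fun i => h.scale_nonneg _ i
  | succ j ih =>
    rw [cutoff, Finset.prod_range_succ, ← cutoff]
    refine (ih.mul (degLE_halfCos (h.pos _))).mono fun i => ?_
    have h1 := h.le_scale_succ (2 * j + 1) i
    have h2 := h.scale_mono i (Nat.le_succ (2 * j))
    simp only [mul_add, mul_one, Nat.succ_eq_add_one] at *
    linarith

theorem Lacunary.degLE_detector (h : Lacunary a M δ) (j : ℕ) :
    DegLE (scale a M (2 * j + 2)) (detector a j) := by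
  have hpos : ∀ i, (0 : ℝ) < a (2 * j) i := fun i => by exact_mod_cast h.pos (2 * j) i
  refine ((degLE_ch (ρ := fun i => (a (2 * j) i : ℝ)) fun i => ?_).mul ((h.degLE_cutoff j).mul
    ((degLE_one fun i => ?_).sub (degLE_halfCos (h.pos _))))).mono fun i => ?_
  · rw [Pi.neg_apply, Int.cast_neg, abs_neg, abs_of_pos (hpos i)]
  · exact_mod_cast (h.pos _ i).le
  · have h1 := h.le_scale_succ (2 * j + 1) i
    have h2 := h.le_scale_succ (2 * j) i
    linarith

/-- By independence the mean factors over frequencies: even ones contribute 1, odd ones the mean of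
a Fejér kernel of order `b` times `halfCos`. -/
theorem Lacunary.coeff_zero_riesz_mul_cutoff (h : Lacunary a M δ) (hδ : δ ≤ 1 / 4) (i : Fin d)
    {b : ℕ} (hb : ∀ j, M (2 * j + 1) = b) (j : ℕ) :
    (riesz a M (2 * j) * cutoff a j).coeff 0 = (1 - (2 * b : ℂ)⁻¹) ^ j := by
  have hM : ∀ k, M k ≠ 0 := fun k => by have := h.two_le k; omega
  induction j with
  | zero => simp [riesz, cutoff]
  | succ j ih =>
    have e : riesz a M (2 * (j + 1)) * cutoff a (j + 1) =
        (riesz a M (2 * j) * cutoff a j) * fejer (M (2 * j)) (a (2 * j)) *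
          (fejer (M (2 * j + 1)) (a (2 * j + 1)) * halfCos (a (2 * j + 1))) := by
      rw [mul_add, mul_one, riesz_succ, riesz_succ, cutoff, Finset.prod_range_succ, ← cutoff]
      ring
    have hd := (h.degLE_riesz (2 * j)).mul (h.degLE_cutoff j)
    have hs := h.scale_nonneg (2 * j) i
    have hs' := h.add_le_scale_succ (2 * j) i
    have hs'' := h.scale_nonneg (2 * j + 1) i
    rw [e, coeff_zero_mul i (hd.mul (degLE_fejer _ (h.pos _))) ((ray_fejer _ _).mul (ray_halfCos _))
      (h.lt_of_le_mul_scale hδ (by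
        have : 0 ≤ (M (2 * j) : ℝ) * a (2 * j) i := by
          have : (0 : ℝ) < a (2 * j) i := by exact_mod_cast h.pos _ i
          positivity
        linarith)),
      coeff_zero_mul i hd (ray_fejer _ _) (h.lt_of_le_mul_scale hδ (by linarith)), ih,
      coeff_zero_fejer (hM _) (h.ne_zero i _), coeff_zero_fejer_mul_halfCos (hM _) (h.ne_zero i _),
      hb, mul_one, pow_succ]

theorem Lacunary.coeff_zero_ch_mul_riesz_mul_detector (h : Lacunary a M δ) (hδ : δ ≤ 1 / 4)
    (i : Fin d) {b : ℕ} (hb : ∀ j, M (2 * j + 1) = b) (B j : ℕ) {z : ℤ} (hz : z = 1 ∨ z = -1) :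
    (ch (z • a (2 * B)) * riesz a M (2 * B) * detector a j).coeff 0 =
      if j = B ∧ z = 1 then (1 - (2 * b : ℂ)⁻¹) ^ B / 2 else 0 := by
  have hz0 : z ≠ 0 := by omega
  have hsc := h.scale_nonneg
  rcases lt_trichotomy j B with hjB | rfl | hjB
  -- Here `a (2 * B)` dominates all other frequencies, and its character has mean zero.
  · rw [if_neg (by omega), mul_assoc, mul_comm]
    have hd := (h.degLE_riesz (2 * B)).mul (h.degLE_detector j)
    have h1 : scale a M (2 * j + 2) i ≤ scale a M (2 * B) i := h.scale_mono i (by omega)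
    have h2 := hsc (2 * B) i
    rw [coeff_zero_mul i hd (ray_ch_zsmul _ z) (h.lt_of_le_mul_scale hδ (by linarith)),
      coeff_zero_ch_zsmul (h.ne_zero i _), if_neg hz0, mul_zero]
  -- The two characters merge into frequency `(z - 1) • a (2 * j)`, which survives only for `z = 1`;
  -- the independent factor `1 - halfCos` has mean `1 / 2`.
  · have e : ch (z • a (2 * j)) * riesz a M (2 * j) * detector a j =
        riesz a M (2 * j) * cutoff a j * ch ((z - 1) • a (2 * j)) *
          (1 - halfCos (a (2 * j + 1))) := by
      have : (ch ((z - 1) • a (2 * j)) : TrigPoly d) = ch (z • a (2 * j)) * ch (-a (2 * j)) := by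
        rw [AddMonoidAlgebra.single_mul_single, sub_smul, one_smul, sub_eq_add_neg, mul_one]
      rw [this, detector]
      ring
    have hd := (h.degLE_riesz (2 * j)).mul (h.degLE_cutoff j)
    have h2 := hsc (2 * j) i
    have h3 := h.two_le (2 * j)
    have hpos : ∀ i, (0 : ℝ) < a (2 * j) i := fun i => by exact_mod_cast h.pos (2 * j) i
    have hc : DegLE (fun i => 2 * (a (2 * j) i : ℝ)) (ch ((z - 1) • a (2 * j)) : TrigPoly d) := by
      refine degLE_ch fun i => ?_
      have : |((z - 1 : ℤ) : ℝ)| ≤ 2 := by rcases hz with rfl | rfl <;> norm_num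
      simp only [Pi.smul_apply, smul_eq_mul, Int.cast_mul, abs_mul, abs_of_pos (hpos i)]
      exact mul_le_mul_of_nonneg_right this (hpos i).le
    rw [e, coeff_zero_mul i (hd.mul hc) ((ray_one _).sub (ray_halfCos _))
      (h.lt_of_le_mul_scale hδ (by
        have h4 := h.add_le_scale_succ (2 * j) i
        have h5 : (2 : ℝ) ≤ M (2 * j) := by exact_mod_cast h3
        have h6 := mul_le_mul_of_nonneg_right h5 (hpos i).le
        have h7 := hsc (2 * j + 1) i
        have h8 := hpos i
        linarith)),
      coeff_zero_mul i hd (ray_ch_zsmul _ _) (h.lt_of_le_mul_scale hδ (by linarith)),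
      h.coeff_zero_riesz_mul_cutoff hδ i hb, coeff_zero_ch_zsmul (h.ne_zero i _),
      coeff_zero_one_sub_halfCos (h.ne_zero i _)]
    rcases hz with rfl | rfl
    · simp; ring
    · norm_num
  -- After splitting off `1 - halfCos`, the detector's own character has the dominant frequency and
  -- mean zero.
  · rw [if_neg (by omega)]
    have e : ch (z • a (2 * B)) * riesz a M (2 * B) * detector a j =
        ch (z • a (2 * B)) * riesz a M (2 * B) * cutoff a j * ch (-a (2 * j)) *
          (1 - halfCos (a (2 * j + 1))) := by
      rw [detector]; ring
    have hposB : ∀ i, (0 : ℝ) < a (2 * B) i := fun i => by exact_mod_cast h.pos (2 * B) i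
    have hposj : ∀ i, (0 : ℝ) < a (2 * j) i := fun i => by exact_mod_cast h.pos (2 * j) i
    have hc : DegLE (fun i => (a (2 * B) i : ℝ)) (ch (z • a (2 * B)) : TrigPoly d) := by
      refine degLE_ch fun i => ?_
      have : |(z : ℝ)| = 1 := by rcases hz with rfl | rfl <;> norm_num
      simp only [Pi.smul_apply, smul_eq_mul, Int.cast_mul, abs_mul, abs_of_pos (hposB i), this,
        one_mul, le_refl]
    have hc' : DegLE (fun i => (a (2 * j) i : ℝ)) (ch (-a (2 * j)) : TrigPoly d) := by
      refine degLE_ch fun i => ?_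
      rw [Pi.neg_apply, Int.cast_neg, abs_neg, abs_of_pos (hposj i)]
    have hd := (hc.mul (h.degLE_riesz (2 * B))).mul (h.degLE_cutoff j)
    have h1 := h.le_scale_succ (2 * B) i
    have h2 : scale a M (2 * B + 1) i ≤ scale a M (2 * j) i := h.scale_mono i (by omega)
    have h3 := h.le_scale_succ (2 * j) i
    have h4 := hsc (2 * j) i
    have h5 := hsc (2 * j + 1) i
    have h6 := hposj i
    rw [e, coeff_zero_mul i (hd.mul hc') ((ray_one _).sub (ray_halfCos _))
      (h.lt_of_le_mul_scale hδ (by linarith)),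
      coeff_zero_mul i hd (ray_ch_neg _) (h.lt_of_le_mul_scale hδ (by linarith)),
      coeff_ch_of_ne (neg_ne_zero.2 (h.ne_zero i _)), mul_zero, zero_mul]

/-- An order 2 kernel has only the nonzero frequencies `± a (2 * B)`, each of weight `1 / 2`. Only
the positive one meets its detector, whose mean brings the second `1 / 2`. -/
theorem Lacunary.coeff_zero_leading_mul_sum_detector (h : Lacunary a M δ) (hδ : δ ≤ 1 / 4)
    (i : Fin d) {b : ℕ} (hb : ∀ j, M (2 * j + 1) = b) {B n : ℕ} (hB : M (2 * B) = 2)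
    (hBn : B < n) (γ α : Fin d → ℕ) :
    (leading γ α a M (2 * B) * ∑ j ∈ Finset.range n, detector a j).coeff 0 =
      symb γ (a (2 * B)) / symb α (a (2 * B)) * (1 - (2 * b : ℂ)⁻¹) ^ B / 4 := by
  have key : ∀ z : ℤ, z = 1 ∨ z = -1 →
      (ch (z • a (2 * B)) * riesz a M (2 * B) * ∑ j ∈ Finset.range n, detector a j).coeff 0 =
        if z = 1 then (1 - (2 * b : ℂ)⁻¹) ^ B / 2 else 0 := by
    intro z hz
    rw [Finset.mul_sum, AddMonoidAlgebra.coeff_sum, Finsupp.finsetSum_apply]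
    simp only [h.coeff_zero_ch_mul_riesz_mul_detector hδ i hb B _ hz]
    by_cases hz1 : z = 1
    · simp [hz1, hBn]
    · simp [hz1]
  have hoff : (Finset.range 2).offDiag = {(1, 0), (0, 1)} := by decide
  have k1 := key 1 (Or.inl rfl)
  have k2 := key (-1) (Or.inr rfl)
  rw [leading, hB, hoff, Finset.sum_pair (by decide)]
  simp only [Nat.cast_one, Nat.cast_zero, sub_zero, zero_sub, smul_mul_assoc, add_mul,
    AddMonoidAlgebra.coeff_smul, AddMonoidAlgebra.coeff_add, Finsupp.smul_apply, Finsupp.add_apply,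
    k1, k2, smul_eq_mul]
  norm_num
  ring

end

section

variable {d : ℕ} {a : ℕ → Fin d → ℤ} {M : ℕ → ℕ} {δ : ℝ}

/-! ### Norm estimates for the extremal polynomial -/

/-- The extremal polynomial built from `2 * b` frequencies. -/
def extremal (α : Fin d → ℕ) (a : ℕ → Fin d → ℤ) (M : ℕ → ℕ) (b : ℕ) : TrigPoly d :=
  ∑ k ∈ Finset.range (2 * b), block α a M k

theorem sum_range_two_mul {E : Type*} [AddCommMonoid E] (g : ℕ → E) (b : ℕ) :
    ∑ k ∈ Finset.range (2 * b), g k = ∑ j ∈ Finset.range b, (g (2 * j) + g (2 * j + 1)) := by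
  induction b with
  | zero => simp
  | succ b ih =>
    rw [Finset.sum_range_succ, ← ih, mul_add, mul_one, Finset.sum_range_succ,
      Finset.sum_range_succ, add_assoc]

theorem Lacunary.degLE_extremal (h : Lacunary a M δ) (α : Fin d → ℕ) (b : ℕ) :
    DegLE (scale a M (2 * b)) (extremal α a M b) :=
  DegLE.sum fun k hk => (h.degLE_block α k).mono fun i =>
    h.scale_mono i (Nat.succ_le_of_lt (Finset.mem_range.1 hk))

/-- The telescoped part has norm at most 2, and the `2 * b` block errors together at most 1. -/
theorem Lacunary.nrm_D_self_extremal_le (h : Lacunary a M δ) (h0 : 0 ≤ δ) (hδ : δ ≤ 1 / 4)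
    (i : Fin d) {b : ℕ} (hb : ∀ k, M k ≤ b) {α : Fin d → ℕ} {n : ℕ} (hn : ∑ i, α i ≤ n)
    (hδn : 2 * b ^ (n + 2) * (2 ^ n * δ) ≤ 1) :
    nrm (D α (extremal α a M b)) ≤ 3 := by
  have e : D α (extremal α a M b) = (riesz a M (2 * b) - riesz a M 0) +
      ∑ k ∈ Finset.range (2 * b), (D α (block α a M k) - leading α α a M k) := by
    rw [Finset.sum_sub_distrib, extremal, map_sum]
    simp only [h.leading_self]
    rw [Finset.sum_range_sub]
    abel
  have h1 := nrm_sub_le (riesz a M (2 * b)) (riesz a M 0)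
  rw [h.nrm_riesz hδ i, h.nrm_riesz hδ i] at h1
  have h2 : nrm (∑ k ∈ Finset.range (2 * b), (D α (block α a M k) - leading α α a M k)) ≤
      (2 * b : ℕ) • ((b : ℝ) ^ (n + 1) * (2 ^ n * δ)) := by
    refine (nrm_sum_le _ _).trans ((Finset.sum_le_card_nsmul _ _ _ fun k _ => ?_).trans_eq
      (by rw [Finset.card_range]))
    refine (h.nrm_D_block_sub_leading_le h0 hδ i α hn k).trans ?_
    rw [ratio_self (fun i => (h.pos k i).ne'), mul_one]
    have := hb k
    gcongr
  rw [nsmul_eq_mul] at h2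
  push_cast at h2
  have h3 : 2 * (b : ℝ) * ((b : ℝ) ^ (n + 1) * (2 ^ n * δ)) = 2 * b ^ (n + 2) * (2 ^ n * δ) := by
    ring
  rw [e]
  have h4 := nrm_add_le (riesz a M (2 * b) - riesz a M 0)
    (∑ k ∈ Finset.range (2 * b), (D α (block α a M k) - leading α α a M k))
  linarith

theorem Lacunary.nrm_D_extremal_le (h : Lacunary a M δ) (h0 : 0 ≤ δ) (hδ : δ ≤ 1 / 4)
    (i : Fin d) {b : ℕ} (hM0 : ∀ j, M (2 * j) = 2) (hM1 : ∀ j, M (2 * j + 1) = b)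
    {γ : Fin d → ℕ} (α : Fin d → ℕ) {n : ℕ} (hn : ∑ i, γ i ≤ n) (hδn : 2 ^ n * δ ≤ 1) {u v : ℝ}
    (hu : ∀ j, ratio γ α (a (2 * j)) ≤ u) (hv : ∀ j, ratio γ α (a (2 * j + 1)) ≤ v) :
    nrm (D γ (extremal α a M b)) ≤ 2 ^ (n + 2) * (b * u) + 2 * (b ^ (n + 2) * v) := by
  rw [extremal, map_sum, sum_range_two_mul]
  refine (nrm_sum_le _ _).trans ((Finset.sum_le_card_nsmul _ _
    (2 * (2 ^ (n + 1) * u) + 2 * ((b : ℝ) ^ (n + 1) * v)) fun j _ => ?_).trans_eq ?_)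
  · refine (nrm_add_le _ _).trans (add_le_add ?_ ?_)
    · refine (h.nrm_D_block_le h0 hδ i α hn hδn _).trans ?_
      have := hu j
      rw [hM0]
      push_cast
      gcongr
    · refine (h.nrm_D_block_le h0 hδ i α hn hδn _).trans ?_
      have := hv j
      rw [hM1]
      gcongr
  · rw [Finset.card_range, nsmul_eq_mul]
    ring

theorem symb_of_pos {q : Fin d → ℤ} (hq : ∀ i, 0 < q i) (γ : Fin d → ℕ) :
    symb γ q = Complex.I ^ (∑ i, γ i) * (mono (fun i => |(q i : ℝ)|) γ : ℝ) := by
  simp only [symb, mono, mul_pow, Finset.prod_mul_distrib, Finset.prod_pow_eq_pow_sum]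
  rw [Complex.ofReal_prod]
  congr 1
  refine Finset.prod_congr rfl fun i _ => ?_
  have : (0 : ℝ) < q i := by exact_mod_cast hq i
  rw [abs_of_pos this]
  push_cast
  rfl

/-- The phase does not depend on the frequency, so the contributions of different blocks to the
pairing add up without cancellation. -/
theorem symb_div_of_pos {q : Fin d → ℤ} (hq : ∀ i, 0 < q i) (γ α : Fin d → ℕ) :
    symb γ q / symb α q =
      Complex.I ^ (∑ i, γ i) / Complex.I ^ (∑ i, α i) * (ratio γ α q : ℝ) := by
  rw [symb_of_pos hq, symb_of_pos hq, ratio, Complex.ofReal_div, mul_div_mul_comm]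

/-- Bernoulli's inequality. Order `b` for the odd kernels keeps the accumulated loss over `b` steps
below one half. -/
theorem half_le_one_sub_pow {b j : ℕ} (hj : j < b) : (1 / 2 : ℝ) ≤ (1 - (2 * b : ℝ)⁻¹) ^ j := by
  have hb : (1 : ℝ) ≤ b := by exact_mod_cast (by omega : 1 ≤ b)
  have hj' : (j : ℝ) ≤ b := by exact_mod_cast hj.le
  have h1 : (2 * b : ℝ)⁻¹ ≤ 1 := inv_le_one_of_one_le₀ (by linarith)
  have h2 := one_add_mul_le_pow (a := -(2 * b : ℝ)⁻¹) (by linarith) j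
  rw [← sub_eq_add_neg] at h2
  refine le_trans ?_ h2
  have h3 : (j : ℝ) * (2 * b : ℝ)⁻¹ ≤ b * (2 * b : ℝ)⁻¹ :=
    mul_le_mul_of_nonneg_right hj' (by positivity)
  have h4 : (b : ℝ) * (2 * b : ℝ)⁻¹ = 1 / 2 := by field_simp
  linarith

theorem Lacunary.le_nrm_D_extremal (h : Lacunary a M δ) (h0 : 0 ≤ δ) (hδ : δ ≤ 1 / 4)
    (i : Fin d) {b : ℕ} (hM0 : ∀ j, M (2 * j) = 2) (hM1 : ∀ j, M (2 * j + 1) = b)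
    {γ : Fin d → ℕ} (α : Fin d → ℕ) {n : ℕ} (hn : ∑ i, γ i ≤ n) (hδn : 2 ^ n * δ ≤ 1) {u v : ℝ}
    (hu : ∀ j, ratio γ α (a (2 * j)) = u) (hv : ∀ j, ratio γ α (a (2 * j + 1)) ≤ v) :
    b * u / 8 - (2 ^ (n + 1) * (2 ^ n * δ) * (b * u) + 2 * (b ^ (n + 2) * v)) ≤
      nrm (D γ (extremal α a M b)) := by
  have hu0 : 0 ≤ u := hu 0 ▸ ratio_nonneg _ _ _
  set H : TrigPoly d := ∑ j ∈ Finset.range b, detector a j with hH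
  have hH1 : ∀ x, ‖ev H x‖ ≤ 1 := norm_ev_sum_detector_le a b
  -- `X` is the main term, bounded below by duality; `Y` collects the Leibniz errors of the even
  -- blocks and all the odd blocks, and is bounded by the triangle inequality.
  set X : TrigPoly d := ∑ j ∈ Finset.range b, leading γ α a M (2 * j) with hX
  set Y : TrigPoly d := ∑ j ∈ Finset.range b,
    ((D γ (block α a M (2 * j)) - leading γ α a M (2 * j)) + D γ (block α a M (2 * j + 1))) with hY
  have e : D γ (extremal α a M b) = X + Y := by
    rw [extremal, map_sum, sum_range_two_mul, hX, hY, ← Finset.sum_add_distrib]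
    refine Finset.sum_congr rfl fun j _ => ?_
    abel
  have hYn : nrm Y ≤ 2 ^ (n + 1) * (2 ^ n * δ) * (b * u) + 2 * (b ^ (n + 2) * v) := by
    refine (nrm_sum_le _ _).trans ((Finset.sum_le_card_nsmul _ _
      (2 ^ (n + 1) * (2 ^ n * δ * u) + 2 * ((b : ℝ) ^ (n + 1) * v)) fun j _ => ?_).trans_eq ?_)
    · refine (nrm_add_le _ _).trans (add_le_add ?_ ?_)
      · refine (h.nrm_D_block_sub_leading_le h0 hδ i α hn _).trans_eq ?_
        rw [hM0, hu]
        norm_num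
      · refine (h.nrm_D_block_le h0 hδ i α hn hδn _).trans ?_
        have := hv j
        rw [hM1]
        gcongr
    · rw [Finset.card_range, nsmul_eq_mul]
      ring
  have hXn : b * u / 8 ≤ ‖(X * H).coeff 0‖ := by
    have e1 : (X * H).coeff 0 = Complex.I ^ (∑ i, γ i) / Complex.I ^ (∑ i, α i) *
        ((∑ j ∈ Finset.range b, u * (1 - (2 * b : ℝ)⁻¹) ^ j / 4 : ℝ) : ℂ) := by
      rw [hX, Finset.sum_mul, AddMonoidAlgebra.coeff_sum, Finsupp.finsetSum_apply,
        Complex.ofReal_sum, Finset.mul_sum]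
      refine Finset.sum_congr rfl fun j hj => ?_
      rw [h.coeff_zero_leading_mul_sum_detector hδ i hM1 (hM0 j) (Finset.mem_range.1 hj),
        symb_div_of_pos (h.pos _), hu]
      push_cast
      ring
    have hle : b * u / 8 ≤ ∑ j ∈ Finset.range b, u * (1 - (2 * b : ℝ)⁻¹) ^ j / 4 := by
      have := Finset.card_nsmul_le_sum (Finset.range b)
        (fun j => u * (1 - (2 * b : ℝ)⁻¹) ^ j / 4) (u / 8) fun j hj => by
          have := mul_le_mul_of_nonneg_left (half_le_one_sub_pow (Finset.mem_range.1 hj)) hu0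
          linarith
      rw [Finset.card_range, nsmul_eq_mul] at this
      linarith
    have hnn : 0 ≤ b * u / 8 := by positivity
    rw [e1, norm_mul, norm_div, norm_pow, norm_pow, Complex.norm_I, one_pow, one_pow, div_one,
      one_mul, Complex.norm_real, Real.norm_of_nonneg (hnn.trans hle)]
    exact hle
  have h1 := norm_coeff_zero_mul_le (D γ (extremal α a M b)) H hH1
  have h2 := norm_coeff_zero_mul_le Y H hH1
  rw [e, add_mul, AddMonoidAlgebra.coeff_add, Finsupp.add_apply] at h1
  have h3 := norm_sub_le ((X * H).coeff 0 + (Y * H).coeff 0) ((Y * H).coeff 0)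
  rw [add_sub_cancel_right] at h3
  rw [e]
  linarith

/-! ### Lower bounds for the best constant -/

theorem isTrigPolyLE_ev {N : ℕ} {f : TrigPoly d} (hf : DegLE (fun _ => N) f) :
    IsTrigPolyLE N (ev f) := by
  refine ⟨f.coeff, fun x => ?_⟩
  rw [ev_apply]
  refine Finset.sum_subset (fun q hq => ?_) fun q _ hq => ?_
  · rw [Fintype.mem_piFinset]
    intro i
    have h : |(q i : ℝ)| ≤ N := hf q (Finsupp.mem_support_iff.1 hq) i
    rw [abs_le] at h
    rw [Finset.mem_Icc]
    exact ⟨by exact_mod_cast h.1, by exact_mod_cast h.2⟩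
  · rw [Finsupp.notMem_support_iff.1 hq, zero_mul]

theorem ofReal_div_le_bestConst {m N : ℕ} {α : ℕ → Fin d → ℕ} {β : Fin d → ℕ} {f : TrigPoly d}
    (hf : DegLE (fun _ => N) f) {A B : ℝ} (hA : 0 < A)
    (hle : ∑ j ∈ Finset.Icc 1 m, nrm (D (α j) f) ≤ A) (hB : B ≤ nrm (D β f)) :
    ENNReal.ofReal (B / A) ≤ bestConst m α β N := by
  refine le_iInf₂ fun K hK => ?_
  have h := hK _ (isTrigPolyLE_ev hf)
  simp only [multiDeriv_ev] at h
  rw [ENNReal.ofReal_le_coe, div_le_iff₀ hA]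
  exact hB.trans (h.trans (mul_le_mul_of_nonneg_left hle K.2))

/-- The single character with frequency `(1, …, 1)` gives a positive lower bound. -/
theorem ofReal_inv_le_bestConst {m N : ℕ} (hm : m ≠ 0) (hN : 1 ≤ N) (α : ℕ → Fin d → ℕ)
    (β : Fin d → ℕ) : ENNReal.ofReal (1 / m) ≤ bestConst m α β N := by
  have hD : ∀ γ : Fin d → ℕ, nrm (D γ (ch (fun _ => 1))) = 1 := fun γ => by
    rw [mult_single, mul_one, ← mul_one (symb γ _), ← smul_eq_mul, ← AddMonoidAlgebra.smul_single,
      nrm_smul, norm_symb]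
    simp [mono, nrm_eq_integral, ev_ch, norm_torusChar]
  refine ofReal_div_le_bestConst (f := ch fun _ => 1) (degLE_ch fun i => ?_)
    (by positivity) ?_ (hD β).ge
  · simpa using hN
  · simp [hD]

end

section

variable {d : ℕ}

/-! ### Choice of the parameters -/

/-- The frequencies `s ^ (E k Λ + e_k Γ)`, where `e_k` is `1` for even `k` and `e` for odd `k`. -/
def freq (s E e : ℕ) (Λ Γ : Fin d → ℕ) (k : ℕ) (i : Fin d) : ℤ :=
  ((s ^ (E * k * Λ i + (if k % 2 = 0 then 1 else e) * Γ i) : ℕ) : ℤ)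

/-- The orders of the Fejér kernels: `2` for even and `b` for odd indices. -/
def order (b : ℕ) (k : ℕ) : ℕ := if k % 2 = 0 then 2 else b

theorem mono_freq (s E e : ℕ) (Λ Γ : Fin d → ℕ) (k : ℕ) (γ : Fin d → ℕ) :
    mono (fun i => |(freq s E e Λ Γ k i : ℝ)|) γ =
      (s : ℝ) ^ (E * k * (γ ⬝ᵥ Λ) + (if k % 2 = 0 then 1 else e) * (γ ⬝ᵥ Γ)) := by
  have h : ∀ i, |(freq s E e Λ Γ k i : ℝ)| ^ γ i =
      (s : ℝ) ^ (E * k * (γ i * Λ i) + (if k % 2 = 0 then 1 else e) * (γ i * Γ i)) := by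
    intro i
    rw [freq, Int.cast_natCast, Nat.abs_cast, Nat.cast_pow, ← pow_mul]
    congr 1
    ring
  rw [mono, Finset.prod_congr rfl fun i _ => h i, Finset.prod_pow_eq_pow_sum,
    Finset.sum_add_distrib, ← Finset.mul_sum, ← Finset.mul_sum]
  rfl

theorem ratio_freq {s : ℕ} (hs : s ≠ 0) (E e : ℕ) {Λ : Fin d → ℕ} (Γ : Fin d → ℕ) (k : ℕ)
    {γ α : Fin d → ℕ} (h : γ ⬝ᵥ Λ = α ⬝ᵥ Λ) :
    ratio γ α (freq s E e Λ Γ k) =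
      (s : ℝ) ^ ((if k % 2 = 0 then 1 else e) * (γ ⬝ᵥ Γ)) /
        (s : ℝ) ^ ((if k % 2 = 0 then 1 else e) * (α ⬝ᵥ Γ)) := by
  have hs' : (s : ℝ) ≠ 0 := by exact_mod_cast hs
  rw [ratio, mono_freq, mono_freq, h, pow_add, pow_add, mul_div_mul_left _ _ (pow_ne_zero _ hs')]

theorem lacunary_freq {s b E e n : ℕ} (hs : 2 ≤ s) (hb : 2 ≤ b) {Λ Γ : Fin d → ℕ}
    (hΛ : ∀ i, 1 ≤ Λ i) (he : 1 ≤ e)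
    (hE : 2 ^ (n + 6) * b ^ (n + 4) * s ^ (e * ∑ i, Γ i) ≤ s ^ E) :
    Lacunary (freq s E e Λ Γ) (order b) (2 ^ (n + 5) * b ^ (n + 2) : ℝ)⁻¹ := by
  have hs0 : 0 < s := by omega
  have hpos : ∀ k i, 0 < freq s E e Λ Γ k i := fun k i => by
    rw [freq]; exact_mod_cast pow_pos hs0 _
  have hMb : ∀ k, order b k ≤ b := fun k => by rw [order]; split_ifs <;> omega
  refine ⟨hpos, fun k => by rw [order]; split_ifs <;> omega, fun k i => ?_⟩
  set δ : ℝ := (2 ^ (n + 5) * b ^ (n + 2) : ℝ)⁻¹ with hδ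
  have hb0 : (1 : ℝ) ≤ b := by exact_mod_cast (by omega : 1 ≤ b)
  have hδ0 : 0 < δ := by positivity
  have hδ1 : δ ≤ 1 := inv_le_one_of_one_le₀
    (one_le_mul_of_one_le_of_one_le (one_le_pow₀ (by norm_num)) (one_le_pow₀ hb0))
  induction k with
  | zero =>
    have : (0 : ℝ) < freq s E e Λ Γ 0 i := by exact_mod_cast hpos 0 i
    simp only [scale, Pi.zero_apply]
    positivity
  | succ k ih =>
    have h1 : (0 : ℝ) < freq s E e Λ Γ k i := by exact_mod_cast hpos k i
    have h2 : (order b k : ℝ) ≤ b := by exact_mod_cast hMb k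
    -- Passing from odd to even `k` lowers the coefficient of `Γ` from `e` to 1. The factor `s ^ (e
    -- * ∑ i, Γ i)` in `hE` compensates for this, and `Λ i ≥ 1` gives at least a full `s ^ E` per
    -- step.
    have hstep : (2 ^ (n + 6) * b ^ (n + 4)) * s ^ (E * k * Λ i + (if k % 2 = 0 then 1 else e) * Γ i)
        ≤ s ^ (E * (k + 1) * Λ i + (if (k + 1) % 2 = 0 then 1 else e) * Γ i) := by
      calc _ ≤ (2 ^ (n + 6) * b ^ (n + 4)) * s ^ (E * k * Λ i + e * ∑ i, Γ i) := by
            refine Nat.mul_le_mul_left _ (Nat.pow_le_pow_right hs0 (Nat.add_le_add_left ?_ _))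
            refine Nat.mul_le_mul ?_ (Finset.single_le_sum (f := Γ) (fun _ _ => Nat.zero_le _)
              (Finset.mem_univ i))
            split_ifs <;> omega
        _ = s ^ (E * k * Λ i) * (2 ^ (n + 6) * b ^ (n + 4) * s ^ (e * ∑ i, Γ i)) := by
            rw [pow_add]; ring
        _ ≤ s ^ (E * k * Λ i) * s ^ E := Nat.mul_le_mul_left _ hE
        _ = s ^ (E * k * Λ i + E) := (pow_add _ _ _).symm
        _ ≤ _ := by
            refine Nat.pow_le_pow_right hs0 ?_
            have h3 : E * (k + 1) * Λ i = E * k * Λ i + E * Λ i := by ring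
            rw [h3]
            exact (Nat.add_le_add_left (Nat.le_mul_of_pos_right E (hΛ i)) _).trans
              (Nat.le_add_right _ _)
    have hstep' : (2 ^ (n + 6) * (b : ℝ) ^ (n + 4)) * freq s E e Λ Γ k i ≤
        freq s E e Λ Γ (k + 1) i := by
      simp only [freq, Int.cast_natCast]
      exact_mod_cast hstep
    have h3 : scale (freq s E e Λ Γ) (order b) (k + 1) i ≤
        b * (b * freq s E e Λ Γ k i + b * freq s E e Λ Γ k i) := by
      simp only [scale]
      have h4 : scale (freq s E e Λ Γ) (order b) k i ≤ b * freq s E e Λ Γ k i :=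
        ih.trans (mul_le_mul_of_nonneg_right (hδ1.trans hb0) h1.le)
      have h5 : (order b k : ℝ) * freq s E e Λ Γ k i ≤ b * freq s E e Λ Γ k i :=
        mul_le_mul_of_nonneg_right h2 h1.le
      exact (mul_le_mul_of_nonneg_left (add_le_add h5 h4) (Nat.cast_nonneg _)).trans
        (mul_le_mul_of_nonneg_right h2 (by positivity))
    refine h3.trans ?_
    refine le_trans (le_of_eq ?_) (mul_le_mul_of_nonneg_left hstep' hδ0.le)
    rw [hδ]
    field_simp
    ring

/-- The lower bound along the sequence of degrees `s ^ (C * s ^ p)`. -/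
theorem exists_le_bestConst (i : Fin d) {m : ℕ} {α : ℕ → Fin d → ℕ} {β Λ Γ : Fin d → ℕ}
    (hm : 2 ≤ m) (hΛpos : ∀ i, 1 ≤ Λ i) (hΛ : ∀ j ∈ Finset.Icc 1 m, α j ⬝ᵥ Λ = β ⬝ᵥ Λ)
    (hβ : β ⬝ᵥ Γ < α 1 ⬝ᵥ Γ) (hα : ∀ j ∈ Finset.Icc 2 m, α j ⬝ᵥ Γ ≤ α 2 ⬝ᵥ Γ)
    {p r : ℕ} (hp : α 2 ⬝ᵥ Γ + p = α 1 ⬝ᵥ Γ) (hr : α 2 ⬝ᵥ Γ + r = β ⬝ᵥ Γ) :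
    ∃ c : ℝ, 0 < c ∧ ∃ C : ℕ, 1 ≤ C ∧ ∀ s N : ℕ, 2 ≤ s → s ^ (C * s ^ p) ≤ N →
      ENNReal.ofReal (c * s ^ r) ≤ bestConst m α β N := by
  have hp1 : 1 ≤ p := by omega
  set n : ℕ := ∑ i, β i + ∑ j ∈ Finset.Icc 1 m, ∑ i, α j i with hn
  have hnβ : ∑ i, β i ≤ n := Nat.le_add_right _ _
  have hnα : ∀ j ∈ Finset.Icc 1 m, ∑ i, α j i ≤ n := fun j hj =>
    (Finset.single_le_sum (f := fun j => ∑ i, α j i) (fun _ _ => Nat.zero_le _) hj).trans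
      (Nat.le_add_left _ _)
  -- Makes `s ^ e ≥ 2 ^ 6 * b ^ (n + 2)` for `b = s ^ p`, so the odd blocks are negligible. `E` is
  -- likewise read off from the hypothesis of `lacunary_freq`, with 2 replaced by `s`.
  set e : ℕ := 6 + p * (n + 2) with he
  set G : ℕ := ∑ i, Γ i with hG
  set E : ℕ := (n + 6) + p * (n + 4) + e * G with hE
  set A : ℝ := m * (2 ^ (n + 2) + 3) with hA
  have hm0 : (0 : ℝ) < m := by exact_mod_cast (by omega : 0 < m)
  have hA0 : 0 < A := by positivity
  refine ⟨(16 * A)⁻¹, by positivity, 2 * E * ∑ i, Λ i + G + 1, by omega, fun s N hs hN => ?_⟩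
  set b : ℕ := s ^ p with hb
  have hs0 : 0 < s := by omega
  have hsR : (0 : ℝ) < s := by exact_mod_cast hs0
  have hs1 : (1 : ℝ) ≤ s := by exact_mod_cast hs0
  have hb2 : 2 ≤ b := hs.trans (Nat.le_self_pow (by omega) s)
  have hbR : (b : ℝ) = s ^ p := by rw [hb, Nat.cast_pow]
  have hb2R : (2 : ℝ) ≤ b := by exact_mod_cast hb2
  set δ : ℝ := (2 ^ (n + 5) * b ^ (n + 2) : ℝ)⁻¹ with hδ
  have hδ0 : 0 < δ := by positivity
  have hδb : 2 * (b : ℝ) ^ (n + 2) * (2 ^ n * δ) = 1 / 16 := by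
    rw [hδ]
    field_simp
    ring
  have hbn : (2 : ℝ) ^ (n + 2) ≤ (b : ℝ) ^ (n + 2) := pow_le_pow_left₀ (by norm_num) hb2R _
  have hδn : 2 ^ (n + 1) * (2 ^ n * δ) ≤ 1 / 32 := by
    have h1 : (2 : ℝ) ^ (n + 2) * (2 ^ n * δ) ≤ (b : ℝ) ^ (n + 2) * (2 ^ n * δ) :=
      mul_le_mul_of_nonneg_right hbn (by positivity)
    have h2 : (2 : ℝ) ^ (n + 2) * (2 ^ n * δ) = 2 * (2 ^ (n + 1) * (2 ^ n * δ)) := by ring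
    linarith
  have hδ2 : 2 ^ n * δ ≤ 1 / 32 := by
    refine le_trans (le_mul_of_one_le_left (by positivity) (one_le_pow₀ (by norm_num))) hδn
  have hδ4 : δ ≤ 1 / 4 := by
    have : δ ≤ 2 ^ n * δ := le_mul_of_one_le_left hδ0.le (one_le_pow₀ (by norm_num))
    linarith
  have hlac : Lacunary (freq s E e Λ Γ) (order b) δ := by
    refine lacunary_freq hs hb2 hΛpos (by omega) ?_
    calc 2 ^ (n + 6) * b ^ (n + 4) * s ^ (e * G)
        ≤ s ^ (n + 6) * b ^ (n + 4) * s ^ (e * G) := by gcongr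
      _ = s ^ E := by rw [hb, hE, ← pow_mul, ← pow_add, ← pow_add]
  have hM0 : ∀ j, order b (2 * j) = 2 := fun j => by simp [order]
  have hM1 : ∀ j, order b (2 * j + 1) = b := fun j => by
    rw [order, if_neg (by omega)]
  have hMb : ∀ k, order b k ≤ b := fun k => by rw [order]; split_ifs <;> omega
  have h1mem : 1 ∈ Finset.Icc 1 m := Finset.mem_Icc.2 ⟨le_rfl, by omega⟩
  have heven : ∀ γ : Fin d → ℕ, γ ⬝ᵥ Λ = α 1 ⬝ᵥ Λ → ∀ j,
      ratio γ (α 1) (freq s E e Λ Γ (2 * j)) = (s : ℝ) ^ (γ ⬝ᵥ Γ) / (s : ℝ) ^ (α 1 ⬝ᵥ Γ) :=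
    fun γ hγ j => by
      rw [ratio_freq (by omega) _ _ _ _ hγ]
      simp
  have hodd : ∀ γ : Fin d → ℕ, γ ⬝ᵥ Λ = α 1 ⬝ᵥ Λ → γ ⬝ᵥ Γ < α 1 ⬝ᵥ Γ → ∀ j,
      ratio γ (α 1) (freq s E e Λ Γ (2 * j + 1)) ≤ ((s : ℝ) ^ e)⁻¹ :=
    fun γ hγ hγ' j => by
      rw [ratio_freq (by omega) _ _ _ _ hγ, if_neg (by omega), div_le_iff₀ (by positivity),
        inv_mul_eq_div, le_div_iff₀ (by positivity), ← pow_add]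
      refine pow_le_pow_right₀ hs1 ?_
      have := Nat.mul_le_mul_left e hγ'
      rw [Nat.succ_eq_add_one, mul_add, mul_one] at this
      exact this
  have hv : 2 * ((b : ℝ) ^ (n + 2) * ((s : ℝ) ^ e)⁻¹) ≤ 1 / 32 := by
    have h1 : (2 : ℝ) ^ 6 * (b : ℝ) ^ (n + 2) ≤ (s : ℝ) ^ e := by
      rw [hbR, ← pow_mul, he, pow_add (s : ℝ) 6]
      have : (2 : ℝ) ≤ s := by exact_mod_cast hs
      exact mul_le_mul_of_nonneg_right (pow_le_pow_left₀ (by norm_num) this 6) (by positivity)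
    rw [← div_eq_mul_inv, ← mul_div_assoc, div_le_iff₀ (by positivity)]
    linarith
  set f := extremal (α 1) (freq s E e Λ Γ) (order b) b with hf
  have hdeg : DegLE (fun _ => (N : ℝ)) f := by
    -- The first unused frequency, of index `2 * b`, bounds the degree; its exponent is at most a
    -- constant times `b = s ^ p`.
    refine (hlac.degLE_extremal (α 1) b).mono fun i => ?_
    refine (hlac.scale_le (2 * b) i).trans ?_
    have h1 : (freq s E e Λ Γ (2 * b) i : ℝ) ≤ N := by
      rw [freq, Int.cast_natCast, Nat.cast_le]
      refine le_trans (Nat.pow_le_pow_right hs0 ?_) hN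
      rw [if_pos (by omega), one_mul]
      have h2 : Λ i ≤ ∑ i, Λ i := Finset.single_le_sum (f := Λ) (fun _ _ => Nat.zero_le _)
        (Finset.mem_univ i)
      have h3 : Γ i ≤ G := Finset.single_le_sum (f := Γ) (fun _ _ => Nat.zero_le _)
        (Finset.mem_univ i)
      have h4 := Nat.mul_le_mul_left (E * (2 * b)) h2
      have h5 : G * 1 ≤ G * b := Nat.mul_le_mul_left G (by omega)
      nlinarith
    have h0 : (0 : ℝ) < freq s E e Λ Γ (2 * b) i := by exact_mod_cast hlac.pos _ i
    refine le_trans (mul_le_of_le_one_left h0.le (by linarith)) h1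
  have hsum : ∑ j ∈ Finset.Icc 1 m, nrm (D (α j) f) ≤ A := by
    refine (Finset.sum_le_card_nsmul _ _ (2 ^ (n + 2) + 3) fun j hj => ?_).trans_eq (by
      rw [Nat.card_Icc, nsmul_eq_mul, hA, Nat.add_sub_cancel])
    rcases eq_or_ne j 1 with rfl | hj1
    · have := hlac.nrm_D_self_extremal_le hδ0.le hδ4 i hMb (hnα 1 h1mem) (by rw [hδb]; norm_num)
      have h2 : (0 : ℝ) < 2 ^ (n + 2) := by positivity
      linarith
    · have hj2 : j ∈ Finset.Icc 2 m := by
        rw [Finset.mem_Icc] at hj ⊢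
        omega
      have hΛj : α j ⬝ᵥ Λ = α 1 ⬝ᵥ Λ := (hΛ j hj).trans (hΛ 1 h1mem).symm
      have hlt : α j ⬝ᵥ Γ < α 1 ⬝ᵥ Γ := by
        have := hα j hj2
        omega
      have h1 := hlac.nrm_D_extremal_le hδ0.le hδ4 i hM0 hM1 (α 1) (hnα j hj) (by linarith)
        (fun k => (heven (α j) hΛj k).le) (hodd (α j) hΛj hlt)
      -- `b = s ^ p` is the largest number of even blocks compatible with this bound, with equality
      -- at `j = 2`.
      have h2 : (b : ℝ) * ((s : ℝ) ^ (α j ⬝ᵥ Γ) / (s : ℝ) ^ (α 1 ⬝ᵥ Γ)) ≤ 1 := by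
        rw [hbR, ← mul_div_assoc, ← pow_add, div_le_one (by positivity)]
        refine pow_le_pow_right₀ hs1 ?_
        have := hα j hj2
        omega
      have h3 : (2 : ℝ) ^ (n + 2) * ((b : ℝ) * ((s : ℝ) ^ (α j ⬝ᵥ Γ) / (s : ℝ) ^ (α 1 ⬝ᵥ Γ))) ≤
          2 ^ (n + 2) * 1 := mul_le_mul_of_nonneg_left h2 (by positivity)
      linarith
  have hlow : (s : ℝ) ^ r / 16 ≤ nrm (D β f) := by
    have hΛβ : β ⬝ᵥ Λ = α 1 ⬝ᵥ Λ := (hΛ 1 h1mem).symm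
    have h1 := hlac.le_nrm_D_extremal hδ0.le hδ4 i hM0 hM1 (α 1) hnβ (by linarith)
      (heven β hΛβ) (hodd β hΛβ hβ)
    have h2 : (b : ℝ) * ((s : ℝ) ^ (β ⬝ᵥ Γ) / (s : ℝ) ^ (α 1 ⬝ᵥ Γ)) = s ^ r := by
      rw [hbR, ← mul_div_assoc, ← pow_add, div_eq_iff (by positivity), ← pow_add]
      congr 1
      omega
    rw [h2] at h1
    have h3 : (1 : ℝ) ≤ s ^ r := one_le_pow₀ hs1
    have h4 : 2 ^ (n + 1) * (2 ^ n * δ) * (s : ℝ) ^ r ≤ 1 / 32 * s ^ r :=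
      mul_le_mul_of_nonneg_right hδn (by positivity)
    linarith
  have := ofReal_div_le_bestConst hdeg hA0 hsum hlow
  convert! this using 2
  field_simp

end

end TrigPoly

end

/-! ### From special degrees to all `N`. -/

theorem exists_pow_mul_pow_le_lt {C p N : ℕ} (hC : 1 ≤ C) (hN : 2 ^ (C * 2 ^ p) ≤ N) :
    ∃ s, 2 ≤ s ∧ s ^ (C * s ^ p) ≤ N ∧ N < (s + 1) ^ (C * (s + 1) ^ p) := by
  have hN2 : 2 ≤ N := (Nat.le_self_pow (by positivity) 2).trans hN
  refine ⟨Nat.findGreatest (fun s => s ^ (C * s ^ p) ≤ N) N,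
    Nat.le_findGreatest hN2 hN, Nat.findGreatest_spec (P := fun s => s ^ (C * s ^ p) ≤ N) hN2 hN, ?_⟩
  set s := Nat.findGreatest (fun s => s ^ (C * s ^ p) ≤ N) N with hs
  by_contra! h
  have hsN : s + 1 ≤ N := (Nat.le_self_pow (by positivity) _).trans h
  exact Nat.findGreatest_is_greatest (P := fun s => s ^ (C * s ^ p) ≤ N) (Nat.lt_succ_self s) hsN h

theorem log_rpow_le_of_lt_pow {C p r s N : ℕ} (hp : 1 ≤ p) (hs : 2 ≤ s) (hN1 : 1 ≤ N)
    (hN : N < (s + 1) ^ (C * (s + 1) ^ p)) :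
    Real.log N ^ ((r : ℝ) / (2 * p)) ≤ ((C : ℝ) * 4 ^ p) ^ ((r : ℝ) / (2 * p)) * s ^ r := by
  have hs' : (2 : ℝ) ≤ s := by exact_mod_cast hs
  have hN0 : (0 : ℝ) < N := by exact_mod_cast hN1
  have hp0 : (p : ℝ) ≠ 0 := by exact_mod_cast (by omega : p ≠ 0)
  have h1 : Real.log N ≤ C * 4 ^ p * (s : ℝ) ^ (2 * p) := by
    have h2 : (N : ℝ) ≤ ((s : ℝ) + 1) ^ (C * (s + 1) ^ p) := by exact_mod_cast hN.le
    have h3 := Real.log_le_log hN0 h2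
    rw [Real.log_pow] at h3
    have h4 : Real.log ((s : ℝ) + 1) ≤ s + 1 := (Real.log_le_sub_one_of_pos (by linarith)).trans
      (by linarith)
    push_cast at h3
    have h5 : ((s : ℝ) + 1) ^ p * (s + 1) ≤ 4 ^ p * (s : ℝ) ^ (2 * p) := by
      calc ((s : ℝ) + 1) ^ p * (s + 1) = (s + 1) ^ (p + 1) := (pow_succ _ _).symm
        -- The factor `1 / 2` in the exponent enters here: the logarithm was replaced by `s + 1`,
        -- and `p + 1 ≤ 2 * p`.
        _ ≤ ((s : ℝ) + 1) ^ (2 * p) := pow_le_pow_right₀ (by linarith) (by omega)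
        _ ≤ (2 * s : ℝ) ^ (2 * p) := pow_le_pow_left₀ (by linarith) (by linarith) _
        _ = 4 ^ p * (s : ℝ) ^ (2 * p) := by
          rw [mul_pow, pow_mul (2 : ℝ)]
          norm_num
    calc Real.log N ≤ C * ((s : ℝ) + 1) ^ p * Real.log (s + 1) := h3
      _ ≤ C * ((s : ℝ) + 1) ^ p * (s + 1) := mul_le_mul_of_nonneg_left h4 (by positivity)
      _ = C * (((s : ℝ) + 1) ^ p * (s + 1)) := by ring
      _ ≤ C * (4 ^ p * (s : ℝ) ^ (2 * p)) := mul_le_mul_of_nonneg_left h5 (by positivity)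
      _ = _ := by ring
  have h6 := Real.rpow_le_rpow (Real.log_nonneg (by exact_mod_cast hN1)) h1
    (by positivity : 0 ≤ (r : ℝ) / (2 * p))
  refine h6.trans_eq ?_
  rw [Real.mul_rpow (by positivity) (by positivity)]
  congr 1
  rw [← Real.rpow_natCast (s : ℝ) (2 * p), ← Real.rpow_mul (by positivity),
    ← Real.rpow_natCast (s : ℝ) r]
  congr 1
  push_cast
  field_simp

theorem theorem1 (d m : ℕ) (hm : 2 ≤ m) (α : ℕ → Fin d → ℕ) (β : Fin d → ℕ)
    (Λ Γ : Fin d → ℕ) (hΛpos : ∀ i, 1 ≤ Λ i) (hΓpos : ∀ i, 1 ≤ Γ i)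
    (hΛ : ∀ j ∈ Finset.Icc 1 m, α j ⬝ᵥ Λ = β ⬝ᵥ Λ)
    (hα₁ : β ⬝ᵥ Γ < α 1 ⬝ᵥ Γ) (hα₂ : α 2 ⬝ᵥ Γ < β ⬝ᵥ Γ)
    (hα : ∀ j, 2 ≤ j → j + 1 ≤ m → α (j + 1) ⬝ᵥ Γ ≤ α j ⬝ᵥ Γ)
    (φ : ℝ)
    (hφ : φ = 1 / 2 * (1 - (((α 1 ⬝ᵥ Γ : ℕ) : ℝ) - ((β ⬝ᵥ Γ : ℕ) : ℝ)) /
      (((α 1 ⬝ᵥ Γ : ℕ) : ℝ) - ((α 2 ⬝ᵥ Γ : ℕ) : ℝ)))) :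
    ∃ C : ℝ, 0 < C ∧ ∀ N : ℕ, 1 ≤ N →
      ENNReal.ofReal (C * Real.log N ^ φ) < bestConst m α β N := by
  obtain ⟨i⟩ : Nonempty (Fin d) := by
    by_contra h
    rw [not_nonempty_iff] at h
    simp [dotProduct] at hα₁
  obtain ⟨p, hp⟩ := Nat.exists_eq_add_of_lt (hα₂.trans hα₁)
  obtain ⟨r, hr⟩ := Nat.exists_eq_add_of_lt hα₂
  rw [add_assoc] at hp hr
  have hαle : ∀ j ∈ Finset.Icc 2 m, α j ⬝ᵥ Γ ≤ α 2 ⬝ᵥ Γ := by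
    intro j hj
    obtain ⟨h2, hjm⟩ := Finset.mem_Icc.1 hj
    induction j, h2 using Nat.le_induction with
    | base => exact le_rfl
    | succ j h2 ih => exact (hα j h2 hjm).trans (ih (Finset.mem_Icc.2 ⟨h2, by omega⟩) (by omega))
  obtain ⟨c, hc, C, hC, hlow⟩ := TrigPoly.exists_le_bestConst i hm hΛpos hΛ hα₁ hαle hp.symm hr.symm
  have hφ' : φ = ((r + 1 : ℕ) : ℝ) / (2 * (p + 1 : ℕ)) := by
    rw [hφ, hp, hr]
    push_cast
    field_simp
    ring
  have hφ0 : 0 < φ := by rw [hφ']; positivity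
  set X : ℝ := ((C : ℝ) * 4 ^ (p + 1)) ^ φ with hX
  set Y : ℝ := Real.log (2 ^ (C * 2 ^ (p + 1)) : ℕ) ^ φ + 1 with hY
  have hX0 : 0 < X := Real.rpow_pos_of_pos (by positivity) _
  have hY0 : 0 < Y := add_pos_of_nonneg_of_pos
    (Real.rpow_nonneg (Real.log_natCast_nonneg _) _) one_pos
  have hm0 : (0 : ℝ) < m := by exact_mod_cast (by omega : 0 < m)
  -- The first entry serves large `N`; the second serves the `N` below the threshold, where a single
  -- character suffices. The factors 2 make both inequalities strict.
  refine ⟨min (c / (2 * X)) (1 / (2 * m * Y)), by positivity, fun N hN => ?_⟩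
  have hlog : 0 ≤ Real.log N ^ φ := Real.rpow_nonneg (Real.log_natCast_nonneg _) _
  by_cases hbig : 2 ^ (C * 2 ^ (p + 1)) ≤ N
  · obtain ⟨s, hs, hsN, hNs⟩ := exists_pow_mul_pow_le_lt hC hbig
    have hs0 : (0 : ℝ) < s := by exact_mod_cast (by omega : 0 < s)
    refine lt_of_lt_of_le ?_ (hlow s N hs hsN)
    rw [ENNReal.ofReal_lt_ofReal_iff (by positivity)]
    have h1 := log_rpow_le_of_lt_pow (r := r + 1) (by omega) hs hN hNs
    rw [← hφ'] at h1
    calc _ ≤ c / (2 * X) * Real.log N ^ φ := mul_le_mul_of_nonneg_right (min_le_left _ _) hlog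
      _ ≤ c / (2 * X) * (X * s ^ (r + 1)) := mul_le_mul_of_nonneg_left h1 (by positivity)
      _ = c * s ^ (r + 1) / 2 := by field_simp
      _ < c * s ^ (r + 1) := half_lt_self (by positivity)
  · refine lt_of_lt_of_le ?_ (TrigPoly.ofReal_inv_le_bestConst (by omega : m ≠ 0) hN α β)
    rw [ENNReal.ofReal_lt_ofReal_iff (by positivity)]
    have h1 : Real.log N ^ φ ≤ Y := by
      have hN0 : (0 : ℝ) < N := by exact_mod_cast hN
      have h2 : Real.log N ≤ Real.log (2 ^ (C * 2 ^ (p + 1)) : ℕ) :=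
        Real.log_le_log hN0 (by exact_mod_cast (not_le.1 hbig).le)
      have h3 := Real.rpow_le_rpow (Real.log_natCast_nonneg _) h2 hφ0.le
      linarith
    calc _ ≤ 1 / (2 * m * Y) * Real.log N ^ φ :=
          mul_le_mul_of_nonneg_right (min_le_right _ _) hlog
      _ ≤ 1 / (2 * m * Y) * Y := mul_le_mul_of_nonneg_left h1 (by positivity)
      _ = 1 / m / 2 := by field_simp
      _ < 1 / m := half_lt_self (by positivity)
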